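/- **Setting.** A sutured surface is a compact oriented surface $F$ with a finite set $\Lambda\subset\partial F$ having an even number of points on each boundary component, a labelling of the components of $\partial F\setminus\Lambda$ as belonging to $S_+$ or $S_-$, alternating across the points of $\Lambda$, and a labelling of each component of $S_+$ as incoming or outgoing, the incoming and the outgoing components each being ordered. Write $h=\operatorname{rk}H_1(F,S_+;\mathbb Z)$. For $A=(A_1,\dots,A_4)\in\mathbb Q^4$ and $N=(N_1,\dots,N_4)\in(\mathbb Z/2)^4$ put $$\delta(F)=-A_1h+(A_1-1)\,a_++A_2\,a_-+A_3\,c+\tfrac{A_1-1}{2}\,\iota+A_4\,o\in\mathbb Q,$$ $$\pi(F)=h+N_1\,a_-+N_2\,c+N_3\,\iota+N_4\,o\in\mathbb Z/2,$$ where $a_\pm$ is the number of non-closed components of $F$ not meeting $S_\pm$, $c$ is the number of closed components of $F$, and $\iota$ and $o$ are the numbers of interval and of circle components of $S_+$. Let $$\mathbf Z^{S_+}_{\delta,\pi}(F)=(\mathbb Z^{0|1})^{\otimes\pi(F)}\otimes\wedge^*H_1(F,S_+;\mathbb Z),$$ with $\pi(F)$ in the exponent read in $\{0,1\}$ and $\varepsilon_F$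 the standard basis element of the prefactor; $\varepsilon_F\otimes\wedge^k H_1(F,S_+;\mathbb Z)$ has degree $k+\delta(F)\in\mathbb Q$ and parity $k+\pi(F)$. For an interval component $I$ of $S_+$ let $\phi_I\colon H_1(F,S_+;\mathbb Z)\xrightarrow{\partial}H_0(S_+;\mathbb Z)\xrightarrow{[I]^*}\mathbb Z$. The algebra $\mathbb Z[E]/(E^2)$, with $E$ odd of degree $-1$, acts as follows: if $I$ is outgoing, on the left by $$E_I\,(\varepsilon_F\otimes v_1\wedge\dots\wedge v_k)=(-1)^{\pi(F)}\sum_{i=1}^k(-1)^{i-1}\phi_I(v_i)\,\varepsilon_F\otimes v_1\wedge\dots\widehat{v_i}\dots\wedge v_k;$$ if $I$ is incoming, on the right by $$(\varepsilon_F\otimes v_1\wedge\dots\wedge v_k)\,E_I=\sum_{i=1}^k(-1)^{k-i}\phi_I(v_i)\,\varepsilon_F\otimes v_1\wedge\dots\widehat{v_i}\dots\wedge v_k.$$ If all components of $S_+$ are intervals, $m$ of them incoming and $n$ outgoing, this is a left action of $(\mathbb Z[E]/(E^2))^{\otimes n}$ and a right action of $(\mathbb Z[E]/(E^2))^{\otimes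 m}$ (tensor products of superalgebras, so odd elements of different factors anticommute), the factors corresponding in order to the outgoing and the incoming components. For $p\ge0$, the open $p$-tuple of pants $\mathcal P$ is the closed disk with $2(p+1)$ sutures, hence $p+1$ intervals of $S_+$, one outgoing (on the left) and $p$ incoming (on the right, ordered from top to bottom, that is, clockwise starting from the outgoing one). For $1\le i\le p$ let $e_i\in H_1(\mathcal P,S_+;\mathbb Z)$ be the class of an arc between the outgoing interval and the $i$-th incoming interval, oriented from the outgoing to the incoming interval if $p-i$ is even and from the incoming to the outgoing interval if $p-i$ is odd. In $(\mathbb Z[E]/(E^2))^{\otimes p}$ let $E_j=1\otimes\dots\otimes1\otimes E\otimes1\otimes\dots\otimes1$ with $E$ in the $j$-th factor. **Proposition.** Let $A_1=1$ and $N_3=0$, the other parameters being arbitrary. Then $e_1,\dots,e_p$ is a basis of $H_1(\mathcal P,S_+;\mathbb Z)$, and the identification $$\varepsilon_{\mathcal P}\otimes(e_{i_1}\wedge\dots\wedge e_{i_k})\ \longleftrightarrow\ E_{j_1}\cdots E_{j_{p-k}},$$ where $1\le i_1<\dots<i_k\le p$ and $j_1<\dots<j_{p-k}$ are the elements of $\{1,\dots,p\}\setminus\{i_1,\dots,i_k\}$,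 gives an isomorphism $$\mathbf Z^{S_+}_{\delta,\pi}(\mathcal P)\cong(\mathbb Z[E]/(E^2))^{\otimes p}$$ of abelian groups that preserves the $\mathbb Q$-degree and the parity and is an isomorphism of (left, right) bimodules over $\bigl(\mathbb Z[E]/(E^2),(\mathbb Z[E]/(E^2))^{\otimes p}\bigr)$. Here $(\mathbb Z[E]/(E^2))^{\otimes p}$ acts on itself on the right by multiplication, and $\mathbb Z[E]/(E^2)$ acts on it on the left by multiplication through the iterated coproduct $\mathbb Z[E]/(E^2)\to(\mathbb Z[E]/(E^2))^{\otimes p}$ obtained from $\Delta(E)=E\otimes1+1\otimes E$ (for $p=0$, through the counit $E\mapsto0$). -/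

import Mathlib

open scoped TensorProduct DirectSum Manifold ContDiff Topology

universe u v

noncomputable section

/-! ### The superalgebras `(R[E]/(E²))^{⊗p}` -/

/-- A `ℤ`-graded algebra over `R`, regarded as a superalgebra: the parity of a homogeneous element
is its degree modulo 2. -/
structure GrAlg (R : Type) [CommRing R] where
  carrier : Type
  [ring : Ring carrier]
  [algebra : Algebra R carrier]
  gr : ℤ → Submodule R carrier
  [graded : GradedAlgebra gr]

attribute [instance] GrAlg.ring GrAlg.algebra GrAlg.graded

namespace GrAlg
variable (R : Type) [CommRing R]

/-- The grading of the ground ring, concentrated in degree `0`. -/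
def unitGr (n : ℤ) : Submodule R R := if n = 0 then ⊤ else ⊥

/-- The grading of `R[E]/(E²)` (Mathlib's dual numbers, with `E = DualNumber.eps`): `1` has degree
`0` and `E` has degree `-1`, so `E` is odd. -/
def dualGr (n : ℤ) : Submodule R (DualNumber R) :=
  if n = 0 then Submodule.span R {1} else if n = -1 then Submodule.span R {DualNumber.eps} else ⊥

theorem dualGr_zero : dualGr R 0 = Submodule.span R {1} := by simp [dualGr]
theorem dualGr_neg_one : dualGr R (-1) = Submodule.span R {DualNumber.eps} := by simp [dualGr]

instance : SetLike.GradedMonoid (unitGr R) where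
  one_mem := by simp [unitGr]
  mul_mem i j a b ha hb := by
    simp only [unitGr] at *
    split_ifs at * <;> simp_all

instance : GradedAlgebra (unitGr R) where
  toDecomposition := DirectSum.Decomposition.ofLinearMap (unitGr R)
    (DirectSum.lof R ℤ (fun i => unitGr R i) 0 ∘ₗ
      LinearMap.codRestrict (unitGr R 0) LinearMap.id (by simp [unitGr]))
    (by ext; simp)
    (by
      ext i ⟨x, hx⟩ : 2
      by_cases h : i = 0
      · subst h
        simp; rfl
      · have : x = 0 := by simpa [unitGr, h] using hx
        subst this
        have : (⟨0, hx⟩ : unitGr R i) = 0 := rfl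
        rw [this]; simp)

instance : SetLike.GradedMonoid (dualGr R) where
  one_mem := by simp [dualGr, Submodule.mem_span_singleton_self]
  mul_mem i j a b ha hb := by
    simp only [dualGr] at *
    split_ifs at ha hb with h1 h2 h3 h4 h5 <;> first
      | (simp only [Submodule.mem_bot] at ha; subst ha; simp)
      | (simp only [Submodule.mem_bot] at hb; subst hb; simp)
      | (obtain ⟨r, rfl⟩ := Submodule.mem_span_singleton.1 ha
         obtain ⟨s, rfl⟩ := Submodule.mem_span_singleton.1 hb
         subst_vars
         simp [Submodule.smul_mem, Submodule.mem_span_singleton_self])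

/-- The degree `0` part. -/
def dualPart0 : DualNumber R →ₗ[R] dualGr R 0 :=
  LinearMap.codRestrict (dualGr R 0)
    (LinearMap.toSpanSingleton R (DualNumber R) 1 ∘ₗ TrivSqZeroExt.fstHom R R R) (by
      intro x
      rw [dualGr_zero]
      exact Submodule.smul_mem _ _ (Submodule.mem_span_singleton_self _))

/-- The degree `-1` part. -/
def dualPart1 : DualNumber R →ₗ[R] dualGr R (-1) :=
  LinearMap.codRestrict (dualGr R (-1))
    (LinearMap.toSpanSingleton R (DualNumber R) DualNumber.eps ∘ₗ TrivSqZeroExt.sndHom R R) (by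
      intro x
      rw [dualGr_neg_one]
      exact Submodule.smul_mem _ _ (Submodule.mem_span_singleton_self _))

instance : GradedAlgebra (dualGr R) where
  toDecomposition := DirectSum.Decomposition.ofLinearMap (dualGr R)
    (DirectSum.lof R ℤ (fun i => dualGr R i) 0 ∘ₗ dualPart0 R +
      DirectSum.lof R ℤ (fun i => dualGr R i) (-1) ∘ₗ dualPart1 R)
    (by ext <;> simp [dualPart0, dualPart1])
    (by
      ext i x : 2
      simp only [LinearMap.comp_apply, DirectSum.coeLinearMap_lof, LinearMap.add_apply,
        LinearMap.id_apply]
      obtain ⟨x, hx⟩ := x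
      dsimp only
      by_cases h : i = 0
      · subst h
        obtain ⟨r, rfl⟩ := Submodule.mem_span_singleton.1 (dualGr_zero R ▸ hx)
        rw [show dualPart0 R (r • 1) = ⟨r • 1, hx⟩ from Subtype.ext (by simp [dualPart0]),
          show dualPart1 R (r • 1) = 0 from Subtype.ext (by simp [dualPart1]), map_zero, add_zero]
      by_cases h : i = -1
      · subst h
        obtain ⟨r, rfl⟩ := Submodule.mem_span_singleton.1 (dualGr_neg_one R ▸ hx)
        rw [show dualPart0 R (r • DualNumber.eps) = 0 from Subtype.ext (by simp [dualPart0]),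
          show dualPart1 R (r • DualNumber.eps) = ⟨r • DualNumber.eps, hx⟩ from
            Subtype.ext (by simp [dualPart1]), map_zero, zero_add]
      · have : x = 0 := by simpa [dualGr, *] using hx
        subst this
        rw [show (⟨0, hx⟩ : dualGr R i) = 0 from rfl]
        simp)

variable {R}

section tensor
variable {A B : Type} [Ring A] [Ring B] [Algebra R A] [Algebra R B]
  (𝒜 : ℤ → Submodule R A) (ℬ : ℤ → Submodule R B) [GradedAlgebra 𝒜] [GradedAlgebra ℬ]

/-- The total grading of the super tensor product `𝒜 ᵍ⊗[R] ℬ`, whose multiplication is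
`(a ⊗ b)(a' ⊗ b') = (-1)^(|b||a'|) aa' ⊗ bb'`. -/
def tensorGr (n : ℤ) : Submodule R (𝒜 ᵍ⊗[R] ℬ) :=
  Submodule.span R {x | ∃ i j : ℤ, i + j = n ∧ ∃ a ∈ 𝒜 i, ∃ b ∈ ℬ j, x = a ᵍ⊗ₜ[R] b}

theorem tmul_mem_tensorGr {i j n : ℤ} (h : i + j = n) {a : A}
    {b : B} (ha : a ∈ 𝒜 i) (hb : b ∈ ℬ j) :
    (a ᵍ⊗ₜ[R] b : 𝒜 ᵍ⊗[R] ℬ) ∈ tensorGr 𝒜 ℬ n :=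
  Submodule.subset_span ⟨i, j, h, a, ha, b, hb, rfl⟩

instance : SetLike.GradedMonoid (tensorGr 𝒜 ℬ) where
  one_mem := tmul_mem_tensorGr 𝒜 ℬ (zero_add 0) SetLike.GradedOne.one_mem SetLike.GradedOne.one_mem
  mul_mem m n x y hx hy := by
    induction hx using Submodule.span_induction with
    | zero => simp
    | add u v _ _ hu hv => rw [add_mul]; exact add_mem hu hv
    | smul r u _ hu => rw [GradedTensorProduct.mul_def, LinearMap.map_smul₂]; exact Submodule.smul_mem _ r hu
    | mem u hu =>
    obtain ⟨i, j, hij, a, ha, b, hb, rfl⟩ := hu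
    induction hy using Submodule.span_induction with
    | zero => simp
    | add u v _ _ hu hv => rw [mul_add]; exact add_mem hu hv
    | smul r u _ hu => rw [GradedTensorProduct.mul_def, map_smul]; exact Submodule.smul_mem _ r hu
    | mem u hu =>
    obtain ⟨k, l, hkl, c, hc, d, hd, rfl⟩ := hu
    have := GradedTensorProduct.tmul_coe_mul_coe_tmul 𝒜 ℬ a ⟨b, hb⟩ ⟨c, hc⟩ d
    dsimp only at this
    rw [this, Units.smul_def]
    refine zsmul_mem (tmul_mem_tensorGr 𝒜 ℬ (i := i + k) (j := j + l) (by omega)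
      (SetLike.GradedMul.mul_mem ha hc) (SetLike.GradedMul.mul_mem hb hd)) _

/-- The decomposition of the super tensor product into homogeneous parts. -/
def tensorDecompose : (𝒜 ᵍ⊗[R] ℬ) →ₗ[R] ⨁ n, tensorGr 𝒜 ℬ n :=
  (TensorProduct.lift
    (DirectSum.toModule R ℤ _ fun i =>
      LinearMap.flip (DirectSum.toModule R ℤ _ fun j => LinearMap.mk₂ R
        (fun (b : ℬ j) (a : 𝒜 i) => DirectSum.lof R ℤ (fun n => tensorGr 𝒜 ℬ n) (i + j)
          ⟨(a : A) ᵍ⊗ₜ[R] (b : B), tmul_mem_tensorGr 𝒜 ℬ rfl a.2 b.2⟩)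
        (fun b b' a => by
          rw [← map_add]; congr 1; ext
          exact congrArg (GradedTensorProduct.of R 𝒜 ℬ) (TensorProduct.tmul_add _ _ _))
        (fun r b a => by
          rw [← map_smul]; congr 1; ext
          exact congrArg (GradedTensorProduct.of R 𝒜 ℬ) (TensorProduct.tmul_smul _ _ _))
        (fun b a a' => by
          rw [← map_add]; congr 1; ext
          exact congrArg (GradedTensorProduct.of R 𝒜 ℬ) (TensorProduct.add_tmul _ _ _))
        (fun r b a => by
          rw [← map_smul]; congr 1)))) ∘ₗ
    (GradedTensorProduct.auxEquiv R 𝒜 ℬ).toLinearMap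

theorem tensorDecompose_tmul {i j n : ℤ} (h : i + j = n) {a : A}
    {b : B} (ha : a ∈ 𝒜 i) (hb : b ∈ ℬ j) :
    tensorDecompose 𝒜 ℬ (a ᵍ⊗ₜ[R] b) = DirectSum.lof R ℤ (fun n => tensorGr 𝒜 ℬ n) n
      ⟨a ᵍ⊗ₜ[R] b, tmul_mem_tensorGr 𝒜 ℬ h ha hb⟩ := by
  subst h
  simp only [tensorDecompose, LinearMap.comp_apply, LinearEquiv.coe_coe]
  rw [GradedTensorProduct.auxEquiv_tmul, DirectSum.decompose_of_mem _ ha,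
    DirectSum.decompose_of_mem _ hb, ← DirectSum.lof_eq_of R, ← DirectSum.lof_eq_of R]
  simp [DirectSum.toModule_lof]

instance : GradedAlgebra (tensorGr 𝒜 ℬ) where
  toDecomposition := DirectSum.Decomposition.ofLinearMap (tensorGr 𝒜 ℬ) (tensorDecompose 𝒜 ℬ)
    (by
      ext : 2
      refine DirectSum.decompose_lhom_ext 𝒜 fun i => ?_
      ext a : 1
      refine DirectSum.decompose_lhom_ext ℬ fun j => ?_
      ext b : 1
      have := tensorDecompose_tmul 𝒜 ℬ rfl a.2 b.2
      simp [this])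
    (by
      ext n ⟨x, hx⟩ : 2
      simp only [LinearMap.comp_apply, DirectSum.coeLinearMap_lof, LinearMap.id_apply]
      have : ∃ h : x ∈ tensorGr 𝒜 ℬ n, tensorDecompose 𝒜 ℬ x =
          DirectSum.lof R ℤ (fun n => tensorGr 𝒜 ℬ n) n ⟨x, h⟩ := by
        induction hx using Submodule.span_induction with
        | mem u hu =>
          obtain ⟨i, j, hij, a, ha, b, hb, rfl⟩ := hu
          exact ⟨_, tensorDecompose_tmul 𝒜 ℬ hij ha hb⟩
        | zero => exact ⟨zero_mem _, by
            rw [map_zero]; exact (map_zero (DirectSum.lof R ℤ (fun n => tensorGr 𝒜 ℬ n) n)).symm⟩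
        | add u v _ _ hu hv =>
          obtain ⟨hu, hu'⟩ := hu
          obtain ⟨hv, hv'⟩ := hv
          exact ⟨add_mem hu hv, by rw [map_add, hu', hv', ← map_add]; rfl⟩
        | smul r u _ hu =>
          obtain ⟨hu, hu'⟩ := hu
          exact ⟨Submodule.smul_mem _ r hu, by rw [map_smul, hu', ← map_smul]; rfl⟩
      exact this.2)

end tensor

variable (R) in
/-- The `p`-fold super tensor power `(R[E]/(E²))^{⊗p} = R[E]/(E²) ⊗ (R[E]/(E²) ⊗ (⋯ ⊗ R))`. -/
def dualPow : ℕ → GrAlg R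
  | 0 => { carrier := R, gr := unitGr R }
  | p + 1 => { carrier := dualGr R ᵍ⊗[R] (dualPow p).gr, gr := tensorGr (dualGr R) (dualPow p).gr }

/-- The algebra homomorphism `a ↦ 1 ⊗ ⋯ ⊗ 1 ⊗ a ⊗ 1 ⊗ ⋯ ⊗ 1`, with `a` in the
`i`-th factor. -/
def incl : (p : ℕ) → Fin p → (DualNumber R →ₐ[R] (dualPow R p).carrier)
  | 0, i => i.elim0
  | p + 1, i => Fin.cases (GradedTensorProduct.includeLeft (dualGr R) (dualPow R p).gr)
      (fun j => (GradedTensorProduct.includeRight (dualGr R) (dualPow R p).gr).comp (incl p j)) i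

theorem eps_mem_dualGr : (DualNumber.eps : DualNumber R) ∈ dualGr R (-1) := by
  rw [dualGr_neg_one]; exact Submodule.mem_span_singleton_self _

/-- The algebra homomorphism `R[E]/(E²) → C` sending `E` to an element `u` with `u² = 0`. -/
def dualLift {C : Type*} [Ring C] [Algebra R C] (u : C) (hu : u * u = 0) :
    DualNumber R →ₐ[R] C :=
  DualNumber.lift ⟨(Algebra.ofId R C, u), hu, fun a => (Algebra.commutes a u).symm⟩

theorem dualLift_eps {C : Type*} [Ring C] [Algebra R C] (u : C) (hu : u * u = 0) :
    dualLift (R := R) u hu DualNumber.eps = u := by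
  simp [dualLift]

theorem dualLift_apply {C : Type*} [Ring C] [Algebra R C] (u : C) (hu : u * u = 0)
    (a : DualNumber R) : dualLift u hu a = a.fst • 1 + a.snd • u := by
  have ha : a = a.fst • 1 + a.snd • DualNumber.eps := by ext <;> simp
  conv_lhs => rw [ha]
  rw [map_add, map_smul, map_smul, map_one, dualLift_eps]

/-- The coproduct `Δ(E) = E ⊗ 1 + 1 ⊗ E`. -/
def coproduct : DualNumber R →ₐ[R] (dualGr R) ᵍ⊗[R] (dualGr R) :=
  dualLift ((DualNumber.eps : DualNumber R) ᵍ⊗ₜ[R] (1 : DualNumber R) +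
      (1 : DualNumber R) ᵍ⊗ₜ[R] (DualNumber.eps : DualNumber R)) (by
    have h1 := GradedTensorProduct.tmul_one_mul_one_tmul (dualGr R) (dualGr R)
      (DualNumber.eps : DualNumber R) (DualNumber.eps : DualNumber R)
    have h2 := GradedTensorProduct.tmul_coe_mul_coe_tmul (dualGr R) (dualGr R)
      (1 : DualNumber R) ⟨DualNumber.eps, eps_mem_dualGr⟩ ⟨DualNumber.eps, eps_mem_dualGr⟩
      (1 : DualNumber R)
    have h3 := GradedTensorProduct.tmul_one_mul_coe_tmul (dualGr R) (dualGr R)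
      (DualNumber.eps : DualNumber R) ⟨DualNumber.eps, eps_mem_dualGr⟩ (1 : DualNumber R)
    have h4 := GradedTensorProduct.tmul_coe_mul_one_tmul (dualGr R) (dualGr R)
      (1 : DualNumber R) ⟨DualNumber.eps, eps_mem_dualGr⟩ (DualNumber.eps : DualNumber R)
    dsimp only at h1 h2 h3 h4
    rw [add_mul, mul_add, mul_add, h1, h2, h3, h4, DualNumber.eps_mul_eps]
    simp [GradedTensorProduct.tmul])

/-- The iterated coproduct `R[E]/(E²) → (R[E]/(E²))^{⊗p}`: the counit `E ↦ 0` for `p = 0`, and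
`(id ⊗ Δ^{(p)}) ∘ Δ` for `p + 1`. -/
def iterCoproduct : (p : ℕ) → (DualNumber R →ₗ[R] (dualPow R p).carrier)
  | 0 => (TrivSqZeroExt.fstHom R R R).toLinearMap
  | p + 1 =>
    (GradedTensorProduct.of R (dualGr R) (dualPow R p).gr).toLinearMap ∘ₗ
      TensorProduct.map LinearMap.id (iterCoproduct p) ∘ₗ
        (GradedTensorProduct.of R (dualGr R) (dualGr R)).symm.toLinearMap ∘ₗ
          coproduct.toLinearMap

section lift
variable {B C : Type*} [Ring B] [Algebra R B] [Ring C] [Algebra R C]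

theorem dualLift_comm (u : C) (hu : u * u = 0) (v : C) (hv : v * u = -(u * v))
    (n : ℤ) (a : DualNumber R) (ha : a ∈ dualGr R n) :
    v * dualLift u hu a = (-1 : ℤˣ) ^ n • (dualLift u hu a * v) := by
  by_cases hn : n = 0
  · subst hn
    obtain ⟨r, rfl⟩ := Submodule.mem_span_singleton.1 (dualGr_zero R ▸ ha)
    simp
  by_cases hn' : n = -1
  · subst hn'
    obtain ⟨r, rfl⟩ := Submodule.mem_span_singleton.1 (dualGr_neg_one R ▸ ha)
    simp [dualLift_eps, hv]
  · have : a = 0 := by simpa [dualGr, *] using ha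
    simp [this]

theorem dualLift_comm' (ℬ : ℤ → Submodule R B) (g : B →ₐ[R] C) (u : C) (hu : u * u = 0)
    (hg : ∀ (n : ℤ), ∀ b ∈ ℬ n, u * g b = (-1 : ℤˣ) ^ n • (g b * u))
    ⦃i j : ℤ⦄ (a : dualGr R i) (b : ℬ j) :
    dualLift u hu a.1 * g b = (-1 : ℤˣ) ^ (j * i) • (g b * dualLift u hu a.1) := by
  obtain ⟨a, ha⟩ := a
  obtain ⟨b, hb⟩ := b
  have hu := hg j b hb
  dsimp only
  by_cases hn : i = 0
  · subst hn
    obtain ⟨r, rfl⟩ := Submodule.mem_span_singleton.1 (dualGr_zero R ▸ ha)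
    simp
  by_cases hn' : i = -1
  · subst hn'
    obtain ⟨r, rfl⟩ := Submodule.mem_span_singleton.1 (dualGr_neg_one R ▸ ha)
    rw [map_smul, dualLift_eps, smul_mul_assoc, mul_smul_comm, hu, mul_neg_one, uzpow_neg,
      Int.units_inv_eq_self, smul_comm]
  · have : a = 0 := by simpa [dualGr, *] using ha
    simp [this]

theorem lift_comm {B : Type} [Ring B] [Algebra R B] (ℬ : ℤ → Submodule R B) [GradedAlgebra ℬ]
    (f : DualNumber R →ₐ[R] C) (g : B →ₐ[R] C)
    (h : ∀ ⦃i j : ℤ⦄ (a : dualGr R i) (b : ℬ j), f a * g b = (-1 : ℤˣ) ^ (j * i) • (g b * f a))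
    (v : C) (hf : ∀ (n : ℤ), ∀ a ∈ dualGr R n, v * f a = (-1 : ℤˣ) ^ n • (f a * v))
    (hg : ∀ (n : ℤ), ∀ b ∈ ℬ n, v * g b = (-1 : ℤˣ) ^ n • (g b * v))
    (n : ℤ) (x : dualGr R ᵍ⊗[R] ℬ) (hx : x ∈ tensorGr (dualGr R) ℬ n) :
    v * GradedTensorProduct.lift (dualGr R) ℬ f g h x =
      (-1 : ℤˣ) ^ n • (GradedTensorProduct.lift (dualGr R) ℬ f g h x * v) := by
  induction hx using Submodule.span_induction with
  | zero => simp
  | add x y _ _ hx hy => rw [map_add, mul_add, add_mul, smul_add, hx, hy]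
  | smul r x _ hx =>
    erw [map_smul]
    rw [mul_smul_comm, hx, smul_mul_assoc, smul_comm]
  | mem x hx =>
    obtain ⟨i, j, rfl, a, ha, b, hb, rfl⟩ := hx
    rw [GradedTensorProduct.lift_tmul, ← mul_assoc, hf i a ha, smul_mul_assoc, mul_assoc,
      hg j b hb, mul_smul_comm, smul_smul, uzpow_add, mul_assoc]

/-- Auxiliary recursion for `powLift`. -/
def powLiftAux : (p : ℕ) → (u : Fin p → C) →
    (∀ i, u i * u i = 0) → (∀ i j, u i * u j = -(u j * u i)) →
    {f : (dualPow R p).carrier →ₐ[R] C // ∀ v : C, (∀ i, v * u i = -(u i * v)) →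
      ∀ (n : ℤ), ∀ b ∈ (dualPow R p).gr n, v * f b = (-1 : ℤˣ) ^ n • (f b * v)}
  | 0, _, _, _ => ⟨Algebra.ofId R C, by
      intro v _ n (b : R) (hb : b ∈ unitGr R n)
      change v * algebraMap R C b = (-1 : ℤˣ) ^ n • (algebraMap R C b * v)
      by_cases h : n = 0
      · subst h
        simp only [uzpow_zero, one_smul]
        exact (Algebra.commutes b v).symm
      · have : b = 0 := by simpa [unitGr, h] using hb
        simp [this]⟩
  | p + 1, u, h0, h1 =>
    let g := powLiftAux p (fun i => u i.succ) (fun i => h0 _) (fun i j => h1 _ _)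
    have h := dualLift_comm' (dualPow R p).gr g.1 (u 0) (h0 0) (g.2 (u 0) (fun i => h1 _ _))
    ⟨GradedTensorProduct.lift (dualGr R) (dualPow R p).gr (dualLift (u 0) (h0 0)) g.1 h,
      fun v hv => lift_comm (dualPow R p).gr _ g.1 h v (dualLift_comm _ _ v (hv 0))
        (g.2 v fun i => hv i.succ)⟩

/-- The universal property of the super tensor power: pairwise anticommuting elements `u i` of
square zero define an algebra homomorphism sending `E` in the `i`-th factor to `u i`. -/
def powLift (p : ℕ) (u : Fin p → C) (h0 : ∀ i, u i * u i = 0)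
    (h1 : ∀ i j, u i * u j = -(u j * u i)) : (dualPow R p).carrier →ₐ[R] C :=
  (powLiftAux p u h0 h1).1

theorem powLift_incl : (p : ℕ) → (u : Fin p → C) → (h0 : ∀ i, u i * u i = 0) →
    (h1 : ∀ i j, u i * u j = -(u j * u i)) → (i : Fin p) →
    powLift (R := R) p u h0 h1 (incl p i DualNumber.eps) = u i
  | 0, _, _, _, i => i.elim0
  | p + 1, u, h0, h1, i => by
    refine Fin.cases ?_ (fun j => ?_) i
    · change dualLift (u 0) (h0 0) DualNumber.eps *
        powLift p (fun i => u i.succ) (fun i => h0 _) (fun i j => h1 _ _) 1 = u 0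
      rw [map_one, mul_one, dualLift_eps]
    · change dualLift (u 0) (h0 0) 1 * powLift p (fun i => u i.succ) (fun i => h0 _)
        (fun i j => h1 _ _) (incl p j DualNumber.eps) = u j.succ
      rw [map_one, one_mul, powLift_incl]

end lift

variable (R) in
/-- The element `E_i = 1 ⊗ ⋯ ⊗ E ⊗ ⋯ ⊗ 1`, with `E` in the `i`-th factor. -/
def E (p : ℕ) (i : Fin p) : (dualPow R p).carrier := incl p i DualNumber.eps

variable (R) in
/-- The product of the `E_j`, `j ∈ s`, in increasing order of `j`. -/
def prodE (p : ℕ) (s : Finset (Fin p)) : (dualPow R p).carrier :=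
  ((s.sort (· ≤ ·)).map (E R p)).prod

/-- The part of `ℚ`-degree `q` and parity `a`. -/
def superGr (B : GrAlg R) (q : ℚ) (a : ZMod 2) : Submodule R B.carrier :=
  ⨆ (n : ℤ) (_ : (n : ℚ) = q ∧ (n : ZMod 2) = a), B.gr n

end GrAlg

/-! ### Relative singular homology in degree one -/

namespace SingularRel

variable (R : Type) [CommRing R] {X : Type u} [TopologicalSpace X]

/-- Singular `n`-simplices in `X`. -/
abbrev Simplex (n : ℕ) (X : Type u) [TopologicalSpace X] : Type u :=
  C(stdSimplex ℝ (Fin (n + 1)), X)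

/-- Singular `n`-chains with coefficients in `R`. -/
abbrev Chain (R : Type) [CommRing R] (n : ℕ) (X : Type u) [TopologicalSpace X] :
    Type u := Simplex n X →₀ R

/-- The `i`-th face of a singular simplex. -/
def face (n : ℕ) (i : Fin (n + 2)) (σ : Simplex (n + 1) X) : Simplex n X :=
  σ.comp ⟨stdSimplex.map i.succAbove, stdSimplex.continuous_map _⟩

/-- The singular boundary operator. -/
def boundary (n : ℕ) : Chain R (n + 1) X →ₗ[R] Chain R n X :=
  Finsupp.lsum R fun σ => ∑ i : Fin (n + 2), LinearMap.toSpanSingleton R _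
    (Finsupp.single (face n i σ) ((-1 : R) ^ (i : ℕ)))

/-- The chains of `X` lying in the subset `S`, that is, the image of `C_n(S)` in `C_n(X)`. -/
def chainsIn (n : ℕ) (S : Set X) : Submodule R (Chain R n X) :=
  Submodule.span R {c | ∃ σ : Simplex n X, Set.range σ ⊆ S ∧ c = Finsupp.single σ 1}

/-- Relative `1`-cycles of `(X, S)`: the `1`-chains of `X` whose boundary lies in `S`. -/
def relCycles (S : Set X) : Submodule R (Chain R 1 X) :=
  (chainsIn R 0 S).comap (boundary R 0)

/-- Relative `1`-boundaries of `(X, S)`: sums of a boundary in `X` and a chain in `S`. -/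
def relBoundaries (S : Set X) : Submodule R (Chain R 1 X) :=
  LinearMap.range (boundary (X := X) R 1) ⊔ chainsIn R 1 S

/-- Relative singular homology `H_1(X, S; R)`: relative cycles modulo relative boundaries. -/
abbrev H1 (S : Set X) : Type u := (relCycles R S).map (relBoundaries R S).mkQ

/-- Singular homology `H_0(S; R)`: `0`-chains in `S` modulo boundaries of `1`-chains in `S`. -/
abbrev H0 (S : Set X) : Type u :=
  (chainsIn R 0 S).map ((chainsIn R 1 S).map (boundary R 0)).mkQ

theorem boundary_single (n : ℕ) (σ : Simplex (n + 1) X) :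
    boundary R n (Finsupp.single σ 1) =
      ∑ i : Fin (n + 2), Finsupp.single (face n i σ) ((-1 : R) ^ (i : ℕ)) := by
  simp [boundary]

theorem face_face_eq (σ : Simplex 2 X) (i j : Fin 3) (k l : Fin 2)
    (h : i.succAbove (k.succAbove 0) = j.succAbove (l.succAbove 0)) :
    face 0 k (face 1 i σ) = face 0 l (face 1 j σ) := by
  ext t
  simp only [face, ContinuousMap.comp_apply, ContinuousMap.coe_mk, stdSimplex.map_comp_apply]
  congr 2
  funext m
  obtain rfl : m = 0 := Subsingleton.elim (α := Fin 1) m 0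
  exact h

theorem boundary_boundary (c : Chain R 2 X) : boundary R 0 (boundary R 1 c) = 0 := by
  have : boundary (X := X) R 0 ∘ₗ boundary R 1 = 0 := by
    ext1 σ
    ext1
    simp only [LinearMap.comp_apply, Finsupp.lsingle_apply, boundary_single, map_sum,
      LinearMap.zero_apply]
    have h (τ : Simplex 1 X) (n : R) : boundary R 0 (Finsupp.single τ n) =
        n • ∑ i : Fin 2, Finsupp.single (face 0 i τ) ((-1 : R) ^ (i : ℕ)) := by
      rw [← boundary_single, ← map_smul, Finsupp.smul_single, smul_eq_mul, mul_one]
    simp only [h]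
    rw [Fin.sum_univ_three]
    simp only [Fin.sum_univ_two]
    rw [face_face_eq σ 0 1 0 0 (by decide), face_face_eq σ 0 2 1 0 (by decide),
      face_face_eq σ 1 2 1 1 (by decide)]
    simp
    abel
  exact LinearMap.congr_fun this c

theorem face_range (n : ℕ) (i : Fin (n + 2)) (σ : Simplex (n + 1) X) :
    Set.range (face n i σ) ⊆ Set.range σ := by
  rintro _ ⟨x, rfl⟩
  exact ⟨_, rfl⟩

theorem relBoundaries_le (S : Set X) : relBoundaries R S ≤
    ((chainsIn R 1 S).map (boundary R 0)).comap (boundary R 0) := by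
  refine sup_le ?_ (fun c hc => ⟨c, hc, rfl⟩)
  rintro _ ⟨c, rfl⟩
  rw [Submodule.mem_comap, boundary_boundary]
  exact zero_mem _

/-- The connecting homomorphism `∂ : H_1(X, S) → H_0(S)`. -/
def connecting (S : Set X) : H1 R S →ₗ[R] H0 R S :=
  LinearMap.restrict (Submodule.mapQ _ _ (boundary R 0) (relBoundaries_le R S)) (by
    rintro _ ⟨c, hc, rfl⟩
    exact ⟨boundary R 0 c, hc, rfl⟩)

/-- The subset of `X` underlying a connected component of the subspace `S`. -/
def componentSet {S : Set X} (I : ConnectedComponents S) : Set X :=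
  {x | ∃ h : x ∈ S, ConnectedComponents.mk (⟨x, h⟩ : S) = I}

open Classical in
/-- The sum of the coefficients of the points lying in `T`. -/
def countIn (T : Set X) : Chain R 0 X →ₗ[R] R :=
  Finsupp.lsum R fun σ => LinearMap.toSpanSingleton R R (if σ default ∈ T then 1 else 0)

theorem countIn_single (T : Set X) (σ : Simplex 0 X) [Decidable (σ default ∈ T)] (n : R) :
    countIn R T (Finsupp.single σ n) = if σ default ∈ T then n else 0 := by
  simp [countIn]

theorem countIn_boundary {S : Set X} (I : ConnectedComponents S) (c : Chain R 1 X)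
    (hc : c ∈ chainsIn R 1 S) : countIn R (componentSet I) (boundary R 0 c) = 0 := by
  classical
  induction hc using Submodule.span_induction with
  | zero => simp
  | add x y _ _ hx hy => rw [map_add, map_add, hx, hy, add_zero]
  | smul r x _ hx => rw [map_smul, map_smul, hx, smul_zero]
  | mem c hc =>
    obtain ⟨σ, hσ, rfl⟩ := hc
    rw [boundary_single, map_sum, Fin.sum_univ_two, countIn_single, countIn_single]
    have hS (t) : σ t ∈ S := hσ ⟨t, rfl⟩
    have key : ∀ s t : stdSimplex ℝ (Fin 2), σ s ∈ componentSet I → σ t ∈ componentSet I := by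
      rintro s t ⟨_, h⟩
      refine ⟨hS t, h ▸ ?_⟩
      have hcont : Continuous fun t : stdSimplex ℝ (Fin 2) => (⟨σ t, hS t⟩ : S) := by fun_prop
      have : PreconnectedSpace (stdSimplex ℝ (Fin 2)) :=
        stdSimplexHomeomorphUnitInterval.symm.surjective.denseRange.preconnectedSpace
          stdSimplexHomeomorphUnitInterval.symm.continuous
      exact ConnectedComponents.coe_eq_coe'.2
        ((isPreconnected_range hcont).subset_connectedComponent ⟨s, rfl⟩ ⟨t, rfl⟩)
    have : face 0 0 σ default ∈ componentSet I ↔ face 0 1 σ default ∈ componentSet I :=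
      ⟨key _ _, key _ _⟩
    simp [this]
    split_ifs <;> simp

/-- Evaluation on `H_0(S)` of the class `[I]^* ∈ H^0(S)` dual to a component `I` of `S`. -/
def dualClass {S : Set X} (I : ConnectedComponents S) : H0 R S →ₗ[R] R :=
  (Submodule.liftQ _ (countIn R (componentSet I)) (by
    rintro _ ⟨d, hd, rfl⟩
    exact countIn_boundary R I d hd)) ∘ₗ Submodule.subtype _

/-- A path as a singular `1`-simplex; vertex `0` goes to the start and vertex `1` to the end. -/
def pathSimplex {x y : X} (γ : Path x y) : Simplex 1 X :=
  γ.toContinuousMap.comp ⟨stdSimplexHomeomorphUnitInterval, by fun_prop⟩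

theorem pathSimplex_mem {S : Set X} {x y : X} (γ : Path x y) (hx : x ∈ S) (hy : y ∈ S) :
    Finsupp.single (pathSimplex γ) (1 : R) ∈ relCycles R S := by
  change boundary R 0 _ ∈ chainsIn R 0 S
  rw [boundary_single, Fin.sum_univ_two]
  have key (z : X) (hz : z ∈ S) (i : Fin 2) (hi : face 0 i (pathSimplex γ) default = z) (n : R) :
      Finsupp.single (face 0 i (pathSimplex γ)) n ∈ chainsIn R 0 S := by
    rw [← mul_one n, ← smul_eq_mul, ← Finsupp.smul_single]
    refine Submodule.smul_mem _ _ (Submodule.subset_span ⟨_, ?_, rfl⟩)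
    rintro _ ⟨t, rfl⟩
    rw [Subsingleton.elim t default, hi]
    exact hz
  have hv : (default : stdSimplex ℝ (Fin 1)) = stdSimplex.vertex 0 := Subsingleton.elim _ _
  refine add_mem (key y hy 0 ?_ _) (key x hx 1 ?_ _)
  · rw [hv]
    simp [face, pathSimplex]
  · rw [hv]
    simp [face, pathSimplex]

/-- The class in `H_1(X, S)` of a path with endpoints in `S`. -/
def arcClass {S : Set X} {x y : X} (γ : Path x y) (hx : x ∈ S) (hy : y ∈ S) : H1 R S :=
  ⟨Submodule.Quotient.mk (Finsupp.single (pathSimplex γ) 1), _, pathSimplex_mem R γ hx hy, rfl⟩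

end SingularRel

/-! ### Exterior algebras with a parity prefactor -/

namespace ShiftedExt

variable (R : Type) [CommRing R] (k : ℕ) (M : Type u) [AddCommGroup M] [Module R M]

/-- The prefactor `(R^{0|1})^{⊗k}`; its parity is recorded in the gradings below. -/
def Prefactor : Type := ⨂[R]^k R

instance : AddCommGroup (Prefactor R k) := inferInstanceAs (AddCommGroup (⨂[R] _ : Fin k, R))

instance : Module R (Prefactor R k) := inferInstanceAs (Module R (⨂[R] _ : Fin k, R))

/-- `(R^{0|1})^{⊗k} ⊗ ⋀* M`. -/
abbrev _root_.ShiftedExt : Type u := Prefactor R k ⊗[R] ExteriorAlgebra R M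

/-- The standard basis element of the prefactor. -/
def ε : Prefactor R k := PiTensorProduct.tprod R fun _ : Fin k => (1 : R)

/-- The summand `(R^{0|1})^{⊗k} ⊗ ⋀^j M`. -/
def wedgePart (j : ℕ) : Submodule R (ShiftedExt R k M) :=
  LinearMap.range ((⋀[R]^j M).subtype.lTensor (Prefactor R k))

variable {M}

/-- The operator `ε ⊗ w ↦ (-1)^k ε ⊗ Φ(w)`, where
`Φ(v_1 ∧ ⋯ ∧ v_j) = ∑ i, (-1)^(i-1) d(v_i) v_1 ∧ ⋯ v̂_i ⋯ ∧ v_j`; see `contractLeft_ιMulti`. -/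
def outOp (d : Module.Dual R M) : Module.End R (ShiftedExt R k M) :=
  (-1 : R) ^ k •
    (CliffordAlgebra.contractLeft (Q := (0 : QuadraticForm R M)) d).lTensor (Prefactor R k)

/-- The operator `ε ⊗ w ↦ ε ⊗ Φ(w)`, where
`Φ(v_1 ∧ ⋯ ∧ v_j) = ∑ i, (-1)^(j-i) d(v_i) v_1 ∧ ⋯ v̂_i ⋯ ∧ v_j`; see `contractRight_ιMulti`. -/
def inOp (d : Module.Dual R M) : Module.End R (ShiftedExt R k M) :=
  ((CliffordAlgebra.contractRight (Q := (0 : QuadraticForm R M))).flip d).lTensor (Prefactor R k)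

theorem contractLeft_ιMulti (d : Module.Dual R M) : (j : ℕ) → (v : Fin (j + 1) → M) →
    CliffordAlgebra.contractLeft (Q := (0 : QuadraticForm R M)) d
        (ExteriorAlgebra.ιMulti R (j + 1) v) =
      ∑ i : Fin (j + 1), ((-1 : R) ^ (i : ℕ) * d (v i)) •
        ExteriorAlgebra.ιMulti R j (fun l => v (i.succAbove l))
  | 0, v => by
    simp [ExteriorAlgebra.ιMulti_apply, Algebra.algebraMap_eq_smul_one]
  | j + 1, v => by
    rw [ExteriorAlgebra.ιMulti_succ_apply]
    erw [CliffordAlgebra.contractLeft_ι_mul]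
    rw [contractLeft_ιMulti d j, Fin.sum_univ_succ (n := j + 1), sub_eq_add_neg, Finset.mul_sum,
      ← Finset.sum_neg_distrib]
    congr 1
    · simp; rfl
    · refine Finset.sum_congr rfl fun i _ => ?_
      rw [ExteriorAlgebra.ιMulti_succ_apply, mul_smul_comm, ← neg_smul]
      congr 1
      · simp [pow_succ, Matrix.vecTail]
      · have h0 : i.succ.succAbove 0 = 0 := Fin.succAbove_ne_zero_zero (Fin.succ_ne_zero i)
        have h1 : (fun l => Matrix.vecTail v (i.succAbove l)) =
            Matrix.vecTail fun l => v (i.succ.succAbove l) := by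
          funext l
          simp [Matrix.vecTail, Fin.succ_succAbove_succ]
        rw [h0, h1]

theorem contractRight_ιMulti (d : Module.Dual R M) : (j : ℕ) → (v : Fin (j + 1) → M) →
    CliffordAlgebra.contractRight (Q := (0 : QuadraticForm R M))
        (ExteriorAlgebra.ιMulti R (j + 1) v) d =
      ∑ i : Fin (j + 1), ((-1 : R) ^ (j - (i : ℕ)) * d (v i)) •
        ExteriorAlgebra.ιMulti R j (fun l => v (i.succAbove l))
  | 0, v => by
    simp [ExteriorAlgebra.ιMulti_apply, Algebra.algebraMap_eq_smul_one]
  | j + 1, v => by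
    have hs (l : ℕ) (u : Fin (l + 1) → M) : ExteriorAlgebra.ιMulti R (l + 1) u =
        ExteriorAlgebra.ιMulti R l (fun i => u i.castSucc) * ExteriorAlgebra.ι R (u (Fin.last l)) := by
      rw [ExteriorAlgebra.ιMulti_apply, ExteriorAlgebra.ιMulti_apply, List.ofFn_succ',
        List.concat_eq_append, List.prod_append, List.prod_singleton]
    rw [hs]
    erw [CliffordAlgebra.contractRight_mul_ι]
    rw [contractRight_ιMulti d j, Fin.sum_univ_castSucc (n := j + 1), sub_eq_add_neg, Finset.sum_mul,
      ← Finset.sum_neg_distrib, add_comm]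
    congr 1
    · refine Finset.sum_congr rfl fun i _ => ?_
      have hi : j + 1 - (i : ℕ) = j - i + 1 := by omega
      rw [hs, smul_mul_assoc, ← neg_smul]
      simp [hi, pow_succ]
    · simp

theorem outOp_anticomm (d d' : Module.Dual R M) :
    outOp R k d * outOp R k d' = -(outOp R k d' * outOp R k d) := by
  refine TensorProduct.ext' fun a w => ?_
  simp [outOp, CliffordAlgebra.contractLeft_comm d d', TensorProduct.tmul_neg]

theorem outOp_sq (d : Module.Dual R M) : outOp R k d * outOp R k d = 0 := by
  refine TensorProduct.ext' fun a w => ?_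
  simp [outOp, CliffordAlgebra.contractLeft_contractLeft]

theorem inOp_anticomm (d d' : Module.Dual R M) :
    inOp R k d * inOp R k d' = -(inOp R k d' * inOp R k d) := by
  refine TensorProduct.ext' fun a w => ?_
  simp [inOp, CliffordAlgebra.contractRight_comm d' d, TensorProduct.tmul_neg]

theorem inOp_sq (d : Module.Dual R M) : inOp R k d * inOp R k d = 0 := by
  refine TensorProduct.ext' fun a w => ?_
  simp [inOp, CliffordAlgebra.contractRight_contractRight]

/-- The left action of `(R[E]/(E²))^{⊗n}` in which the `i`-th `E` acts by `outOp (d i)`. -/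
def leftAction {n : ℕ} (d : Fin n → Module.Dual R M) :
    (GrAlg.dualPow R n).carrier →ₐ[R] Module.End R (ShiftedExt R k M) :=
  GrAlg.powLift n (fun i => outOp R k (d i)) (fun _ => outOp_sq R k _)
    (fun _ _ => outOp_anticomm R k _ _)

/-- The right action of `(R[E]/(E²))^{⊗n}` in which the `i`-th `E` acts by `inOp (d i)`. -/
def rightAction {n : ℕ} (d : Fin n → Module.Dual R M) :
    (GrAlg.dualPow R n).carrier →ₐ[R] (Module.End R (ShiftedExt R k M))ᵐᵒᵖ :=
  GrAlg.powLift n (fun i => MulOpposite.op (inOp R k (d i)))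
    (fun _ => by rw [← MulOpposite.op_mul, inOp_sq, MulOpposite.op_zero])
    (fun _ _ => by rw [← MulOpposite.op_mul, inOp_anticomm, MulOpposite.op_neg,
      MulOpposite.op_mul])

end ShiftedExt

open SingularRel

/-- A sutured surface `(F, Λ, S₊, S₋, ℓ)` whose `S₊` has `m` incoming and `n` outgoing components:
a cobordism from `m` to `n` components. -/
structure SuturedSurface (m n : ℕ) where
  /-- The underlying compact surface `F` with (possibly empty) boundary. -/
  carrier : Type u
  [top : TopologicalSpace carrier]
  [t2 : T2Space carrier]
  [compact : CompactSpace carrier]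
  [charted : ChartedSpace (EuclideanHalfSpace 2) carrier]
  [smooth : IsManifold (𝓡∂ 2) ∞ carrier]
  /-- The atlas is an oriented atlas: the coordinate changes have positive Jacobian determinant. -/
  oriented : ∀ e ∈ atlas (EuclideanHalfSpace 2) carrier,
    ∀ e' ∈ atlas (EuclideanHalfSpace 2) carrier, ∀ x ∈ e.source ∩ e'.source,
      0 < (fderivWithin ℝ ((𝓡∂ 2) ∘ e' ∘ e.symm ∘ (𝓡∂ 2).symm) (Set.range (𝓡∂ 2))
        ((𝓡∂ 2) (e x))).det
  /-- The sutures, an even number of points on each boundary component. -/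
  Λ : Set carrier
  Splus : Set carrier
  Sminus : Set carrier
  Λ_subset : Λ ⊆ (𝓡∂ 2).boundary carrier
  Λ_finite : Λ.Finite
  Λ_even : ∀ x ∈ (𝓡∂ 2).boundary carrier,
    Even (Λ ∩ connectedComponentIn ((𝓡∂ 2).boundary carrier) x).ncard
  /-- Every component of `∂F \ Λ` belongs to exactly one of `S₊` and `S₋`. -/
  disjoint : Disjoint Splus Sminus
  union : Splus ∪ Sminus = (𝓡∂ 2).boundary carrier \ Λ
  plus_component : ∀ x ∈ Splus,
    connectedComponentIn ((𝓡∂ 2).boundary carrier \ Λ) x ⊆ Splus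
  minus_component : ∀ x ∈ Sminus,
    connectedComponentIn ((𝓡∂ 2).boundary carrier \ Λ) x ⊆ Sminus
  /-- The labels alternate across the sutures. -/
  alternating : ∀ x ∈ Λ, x ∈ closure Splus ∧ x ∈ closure Sminus
  /-- The incoming components of `S₊`, in order. -/
  inc : Fin m → ConnectedComponents Splus
  /-- The outgoing components of `S₊`, in order. -/
  out : Fin n → ConnectedComponents Splus
  /-- Every component of `S₊` is listed exactly once, as incoming or as outgoing. -/
  label_bijective : Function.Bijective (Sum.elim inc out)

attribute [instance] SuturedSurface.top SuturedSurface.t2 SuturedSurface.compact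
  SuturedSurface.charted SuturedSurface.smooth

namespace SuturedSurface

variable (R : Type) [CommRing R] {m n : ℕ} (F : SuturedSurface.{u} m n)

/-- The boundary `∂F`. -/
abbrev bdry : Set F.carrier := (𝓡∂ 2).boundary F.carrier

/-- `H_1(F, S₊; R)`. -/
abbrev H : Type u := H1 R F.Splus

/-- The rank of `H_1(F, S₊; R)`. -/
def rankH : ℕ := Module.finrank R (F.H R)

/-- `h = rk H_1(F, S₊; ℤ)`. -/
abbrev h : ℕ := F.rankH ℤ

/-- The component `I` of `S₊` is an (open) interval. -/
def IsInterval (I : ConnectedComponents F.Splus) : Prop :=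
  Nonempty (componentSet I ≃ₜ Set.Ioo (0 : ℝ) 1)

/-- The component `I` of `S₊` is a circle. -/
def IsCircle (I : ConnectedComponents F.Splus) : Prop :=
  Nonempty (componentSet I ≃ₜ Circle)

/-- The connected component `C` of `F` meets `T`. -/
def Meets (C : ConnectedComponents F.carrier) (T : Set F.carrier) : Prop :=
  ∃ x ∈ T, ConnectedComponents.mk x = C

/-- The number of non-closed components of `F` without `S₊`. -/
def numNoPlus : ℕ := {C | F.Meets C F.bdry ∧ ¬ F.Meets C F.Splus}.ncard
/-- The number of non-closed components of `F` without `S₋`. -/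
def numNoMinus : ℕ := {C | F.Meets C F.bdry ∧ ¬ F.Meets C F.Sminus}.ncard
/-- The number of closed components of `F`. -/
def numClosed : ℕ := {C | ¬ F.Meets C F.bdry}.ncard
/-- The number of interval components of `S₊`. -/
def numIntervals : ℕ := {I | F.IsInterval I}.ncard
/-- The number of circle components of `S₊`. -/
def numCircles : ℕ := {I | F.IsCircle I}.ncard

/-- The degree shift `δ_{A₁,A₂,A₃,A₄}(F)`, with `A₁, A₂, A₃, A₄` written `A 0, A 1, A 2, A 3`. -/
def δ (A : Fin 4 → ℚ) : ℚ :=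
  -A 0 * F.h + (A 0 - 1) * F.numNoPlus + A 1 * F.numNoMinus + A 2 * F.numClosed +
    (A 0 - 1) / 2 * F.numIntervals + A 3 * F.numCircles

/-- The parity shift `π_{N₁,N₂,N₃,N₄}(F)`, with `N₁, N₂, N₃, N₄` written `N 0, N 1, N 2, N 3`. -/
def parity (N : Fin 4 → ZMod 2) : ZMod 2 :=
  F.h + N 0 * F.numNoMinus + N 1 * F.numClosed + N 2 * F.numIntervals + N 3 * F.numCircles

variable (N : Fin 4 → ZMod 2)

/-- The module `Z^{S₊}_{δ,π}(F) = (R^{0|1})^{⊗π(F)} ⊗ ⋀* H_1(F, S₊; R)`, without its gradings. -/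
abbrev Z : Type u := ShiftedExt R (F.parity N).val (F.H R)

/-- The element `ε_F ⊗ w`. -/
def pureTensor (w : ExteriorAlgebra R (F.H R)) : F.Z R N :=
  ShiftedExt.ε R (F.parity N).val ⊗ₜ[R] w

/-- The part of `Z^{S₊}_{δ,π}(F)` of `ℚ`-degree `q` and parity `a`: `⋀^k` sits in degree `k + δ(F)`
and has parity `k + π(F)`. -/
def gr (A : Fin 4 → ℚ) (q : ℚ) (a : ZMod 2) : Submodule R (F.Z R N) :=
  ⨆ (k : ℕ) (_ : (k : ℚ) + F.δ A = q ∧ (k : ZMod 2) + F.parity N = a),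
    ShiftedExt.wedgePart R (F.parity N).val (F.H R) k

/-- The map `φ_I : H_1(F, S₊) → H_0(S₊) → R`, the connecting map followed by `[I]^*`. -/
def φ (I : ConnectedComponents F.Splus) : Module.Dual R (F.H R) :=
  dualClass R I ∘ₗ connecting R F.Splus

/-- The left action on `Z^{S₊}_{δ,π}(F)` of one copy of `R[E]/(E²)` for each outgoing component of
`S₊`, for `F` all of whose outgoing components are intervals. -/
def lact (a : (GrAlg.dualPow R n).carrier) (z : F.Z R N) : F.Z R N :=
  ShiftedExt.leftAction R (F.parity N).val (fun i => F.φ R (F.out i)) a z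

/-- The right action on `Z^{S₊}_{δ,π}(F)` of one copy of `R[E]/(E²)` for each incoming component of
`S₊`, for `F` all of whose incoming components are intervals. -/
def ract (z : F.Z R N) (a : (GrAlg.dualPow R m).carrier) : F.Z R N :=
  (ShiftedExt.rightAction R (F.parity N).val (fun i => F.φ R (F.inc i)) a).unop z

/-- An isomorphism of sutured surfaces: an orientation-preserving diffeomorphism respecting
`Λ`, `S₊`, `S₋` and the ordered lists of incoming and outgoing components. -/
structure Iso (F : SuturedSurface.{u} m n) (G : SuturedSurface.{v} m n) where
  diffeo : Diffeomorph (𝓡∂ 2) (𝓡∂ 2) F.carrier G.carrier ∞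
  oriented : ∀ x, 0 < (mfderiv (𝓡∂ 2) (𝓡∂ 2) diffeo x :
    EuclideanSpace ℝ (Fin 2) →L[ℝ] EuclideanSpace ℝ (Fin 2)).det
  map_Λ : diffeo '' F.Λ = G.Λ
  map_plus : diffeo '' F.Splus = G.Splus
  map_minus : diffeo '' F.Sminus = G.Sminus
  map_inc : ∀ i, diffeo '' componentSet (F.inc i) = componentSet (G.inc i)
  map_out : ∀ i, diffeo '' componentSet (F.out i) = componentSet (G.out i)

end SuturedSurface

/-! ### The open `p`-tuple of pants -/

namespace Disk

/-- The closed unit disk in `ℂ`, made into an oriented smooth surface with boundary by the Cayley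
charts `z ↦ (1 + s z) / (1 - s z)`, `|s| = 1`, onto the closed right half-plane. -/
abbrev D : Type := Metric.closedBall (0 : ℂ) 1

/-- `ℂ` as `ℝ²`. -/
abbrev L : ℂ ≃L[ℝ] EuclideanSpace ℝ (Fin 2) :=
  Complex.orthonormalBasisOneI.repr.toContinuousLinearEquiv

theorem L_zero (w : ℂ) : L w 0 = w.re := by simp [L, Complex.orthonormalBasisOneI_repr_apply]
theorem L_symm_re (y : EuclideanSpace ℝ (Fin 2)) : (L.symm y).re = y 0 := by
  rw [← L_zero, L.apply_symm_apply]

theorem D_norm_le (z : D) : ‖(z : ℂ)‖ ≤ 1 := mem_closedBall_zero_iff.1 z.2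

theorem cayley_re (z : ℂ) : ((1 + z) / (1 - z)).re = (1 - ‖z‖ ^ 2) / ‖1 - z‖ ^ 2 := by
  rw [Complex.div_re, ← Complex.normSq_eq_norm_sq, ← Complex.normSq_eq_norm_sq]
  simp [Complex.normSq_apply]
  ring

theorem norm_smul (s : Circle) (z : D) : ‖(s : ℂ) * z‖ = ‖(z : ℂ)‖ := by
  rw [norm_mul, Circle.norm_coe, one_mul]

theorem cayley_re_nonneg (s : Circle) (z : D) :
    0 ≤ ((1 + (s : ℂ) * z) / (1 - (s : ℂ) * z)).re := by
  rw [cayley_re, norm_smul]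
  have := D_norm_le z
  have h0 := norm_nonneg (z : ℂ)
  exact div_nonneg (by nlinarith) (by positivity)

theorem add_one_ne_zero {w : ℂ} (h : 0 ≤ w.re) : w + 1 ≠ 0 := by
  intro h'
  have := congrArg Complex.re h'
  simp at this
  linarith

theorem inv_norm_le {w : ℂ} (h : 0 ≤ w.re) : ‖(w - 1) / (w + 1)‖ ≤ 1 := by
  rw [norm_div, div_le_one (norm_pos_iff.2 (add_one_ne_zero h))]
  rw [← sq_le_sq₀ (norm_nonneg _) (norm_nonneg _), ← Complex.normSq_eq_norm_sq,
    ← Complex.normSq_eq_norm_sq]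
  simp [Complex.normSq_apply]
  nlinarith

/-- The Cayley chart `z ↦ (1 + s z) / (1 - s z)`, defined away from `s⁻¹`. -/
def chart (s : Circle) : OpenPartialHomeomorph D (EuclideanHalfSpace 2) where
  toFun z := ⟨L ((1 + (s : ℂ) * z) / (1 - (s : ℂ) * z)), by
    rw [L_zero]; exact cayley_re_nonneg s z⟩
  invFun y := ⟨(s : ℂ)⁻¹ * ((L.symm y.1 - 1) / (L.symm y.1 + 1)), by
    have := inv_norm_le (w := L.symm y.1) (by rw [L_symm_re]; exact y.2)
    rw [mem_closedBall_zero_iff, norm_mul, norm_inv, Circle.norm_coe, inv_one, one_mul]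
    exact this⟩
  source := {z | (s : ℂ) * z ≠ 1}
  target := Set.univ
  map_source' := by simp
  map_target' := by
    intro y _
    have h := add_one_ne_zero (w := L.symm y.1) (by rw [L_symm_re]; exact y.2)
    simp only [Set.mem_ofPred_eq]
    rw [mul_inv_cancel_left₀ s.coe_ne_zero, Ne, div_eq_one_iff_eq h]
    intro h'
    have := congrArg Complex.re h'
    simp at this
    linarith
  left_inv' := by
    intro z hz
    have hz' : 1 - (s : ℂ) * z ≠ 0 := sub_ne_zero.2 (Ne.symm hz)
    have hs := s.coe_ne_zero
    ext
    simp only [ContinuousLinearEquiv.symm_apply_apply]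
    have : (1 + (s : ℂ) * z) / (1 - (s : ℂ) * z) + 1 = 2 / (1 - (s : ℂ) * z) := by
      field_simp; ring
    rw [this]
    field_simp
    ring
  right_inv' := by
    intro y _
    have h := add_one_ne_zero (w := L.symm y.1) (by rw [L_symm_re]; exact y.2)
    apply EuclideanHalfSpace.ext
    simp only
    rw [mul_inv_cancel_left₀ s.coe_ne_zero]
    rw [← ContinuousLinearEquiv.eq_symm_apply]
    field_simp
    ring
  open_source := by
    apply isOpen_ne_fun <;> fun_prop
  open_target := isOpen_univ
  continuousOn_toFun := by
    refine Topology.IsInducing.subtypeVal.continuousOn_iff.2 ?_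
    refine L.continuous.comp_continuousOn (ContinuousOn.div (by fun_prop) (by fun_prop) ?_)
    intro z hz
    exact sub_ne_zero.2 (Ne.symm hz)
  continuousOn_invFun := by
    apply Continuous.continuousOn
    apply Continuous.subtype_mk
    have hc : Continuous fun y : EuclideanHalfSpace 2 => L.symm y.1 :=
      L.symm.continuous.comp continuous_subtype_val
    refine continuous_const.mul (Continuous.div (hc.sub continuous_const)
      (hc.add continuous_const) ?_)
    intro y
    exact add_one_ne_zero (w := L.symm y.1) (by rw [L_symm_re]; exact y.2)

/-- The coordinate change between two charts, in complex coordinates. -/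
def trans (t w : ℂ) : ℂ := (1 + t * ((w - 1) / (w + 1))) / (1 - t * ((w - 1) / (w + 1)))

theorem trans_eq (s s' : Circle) :
    Set.EqOn ((𝓡∂ 2) ∘ chart s' ∘ (chart s).symm ∘ (𝓡∂ 2).symm)
      (L ∘ trans (s' * (s : ℂ)⁻¹) ∘ L.symm) (Set.range (𝓡∂ 2)) := by
  rintro _ ⟨y, rfl⟩
  simp only [Function.comp_apply, ModelWithCorners.left_inv]
  change L _ = L _
  congr 1
  simp only [trans, chart, mul_assoc]
  rfl

theorem trans_ne {s s' : Circle} {y : EuclideanHalfSpace 2}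
    (h : (chart s).symm y ∈ (chart s').source) :
    1 - (s' * (s : ℂ)⁻¹) * ((L.symm y.1 - 1) / (L.symm y.1 + 1)) ≠ 0 := by
  have h' : (s' : ℂ) * ((s : ℂ)⁻¹ * ((L.symm y.1 - 1) / (L.symm y.1 + 1))) ≠ 1 := h
  rw [mul_assoc]
  exact sub_ne_zero.2 (Ne.symm h')

theorem trans_hasDerivAt {t w : ℂ} (hw : w + 1 ≠ 0) (h : 1 - t * ((w - 1) / (w + 1)) ≠ 0) :
    HasDerivAt (trans t) (4 * t / ((1 - t * ((w - 1) / (w + 1))) * (w + 1)) ^ 2) w := by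
  have h1 : HasDerivAt (fun w : ℂ => (w - 1) / (w + 1)) (2 / (w + 1) ^ 2) w := by
    refine (((hasDerivAt_id w).sub_const 1).div ((hasDerivAt_id w).add_const 1) hw).congr_deriv ?_
    congr 1
    simp only [id]
    ring
  have h2 := h1.const_mul t
  refine ((h2.const_add 1).div (h2.const_sub 1) h).congr_deriv ?_
  have h3 : 1 + t * ((w - 1) / (w + 1)) = 2 - (1 - t * ((w - 1) / (w + 1))) := by ring
  rw [h3]
  generalize 1 - t * ((w - 1) / (w + 1)) = d at *
  generalize w + 1 = c at *
  field_simp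
  ring

theorem trans_contDiffAt {t w : ℂ} (hw : w + 1 ≠ 0) (h : 1 - t * ((w - 1) / (w + 1)) ≠ 0) :
    ContDiffAt ℝ ∞ (trans t) w := by
  have h1 : ContDiffAt ℂ ∞ (fun w : ℂ => (w - 1) / (w + 1)) w :=
    ContDiffAt.div (by fun_prop) (by fun_prop) hw
  have h2 : ContDiffAt ℂ ∞ (fun w : ℂ => t * ((w - 1) / (w + 1))) w := contDiffAt_const.mul h1
  exact ((contDiffAt_const.add h2).div (contDiffAt_const.sub h2) h).restrict_scalars ℝ

theorem det_smul_pos {a : ℂ} (ha : a ≠ 0) :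
    0 < ((L.toContinuousLinearMap ∘L (a • (1 : ℂ →L[ℝ] ℂ)) ∘L L.symm.toContinuousLinearMap :
      EuclideanSpace ℝ (Fin 2) →L[ℝ] EuclideanSpace ℝ (Fin 2))).det := by
  have h : LinearMap.det (LinearMap.mul ℝ ℂ a) = Complex.normSq a := by
    rw [← Algebra.norm_complex_apply]; rfl
  have h2 := LinearMap.det_conj (LinearMap.mul ℝ ℂ a) L.toLinearEquiv
  rw [h] at h2
  refine (Complex.normSq_pos.2 ha).trans_eq ?_
  rw [← h2]
  rfl

theorem chart_oriented (s s' : Circle) (x : D) (hx : x ∈ (chart s).source ∩ (chart s').source) :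
    0 < (fderivWithin ℝ ((𝓡∂ 2) ∘ chart s' ∘ (chart s).symm ∘ (𝓡∂ 2).symm) (Set.range (𝓡∂ 2))
        ((𝓡∂ 2) (chart s x))).det := by
  have hw := add_one_ne_zero (w := L.symm (chart s x).1) (by rw [L_symm_re]; exact (chart s x).2)
  have hd := trans_ne (s := s) (s' := s') (y := chart s x)
    (by rw [(chart s).left_inv hx.1]; exact hx.2)
  have hmem : (𝓡∂ 2) (chart s x) ∈ Set.range (𝓡∂ 2) := ⟨_, rfl⟩
  rw [fderivWithin_congr (trans_eq s s') (trans_eq s s' hmem)]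
  have h1 := (trans_hasDerivAt hw hd).complexToReal_fderiv
  have h2 : HasFDerivAt (L ∘ trans (s' * (s : ℂ)⁻¹) ∘ L.symm) _ ((𝓡∂ 2) (chart s x)) :=
    L.hasFDerivAt.comp _ (h1.comp _ L.symm.hasFDerivAt)
  rw [h2.hasFDerivWithinAt.fderivWithin ((𝓡∂ 2).uniqueDiffOn _ hmem)]
  apply det_smul_pos
  refine div_ne_zero (mul_ne_zero (by norm_num) ?_) (pow_ne_zero _ (mul_ne_zero hd hw))
  exact mul_ne_zero s'.coe_ne_zero (inv_ne_zero s.coe_ne_zero)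

open Classical in
instance : ChartedSpace (EuclideanHalfSpace 2) D where
  atlas := Set.range chart
  chartAt z := if (z : ℂ) = 1 then chart (Circle.exp Real.pi) else chart 1
  mem_chart_source z := by
    split_ifs with h
    · simp [chart, h]; norm_num
    · simpa [chart] using h
  chart_mem_atlas z := by split_ifs <;> exact ⟨_, rfl⟩

instance : IsManifold (𝓡∂ 2) ∞ D := by
  refine isManifold_of_contDiffOn _ _ _ ?_
  rintro _ _ ⟨s, rfl⟩ ⟨s', rfl⟩
  rintro _ ⟨hy, y, rfl⟩
  simp only [Set.mem_preimage, ModelWithCorners.left_inv] at hy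
  have hw := add_one_ne_zero (w := L.symm y.1) (by rw [L_symm_re]; exact y.2)
  have hd := trans_ne (s := s) (s' := s') (y := y) hy.2
  have h1 : ContDiffAt ℝ ∞ (L ∘ trans (s' * (s : ℂ)⁻¹) ∘ L.symm) ((𝓡∂ 2) y) :=
    L.contDiff.contDiffAt.comp _
      (ContDiffAt.comp _ (trans_contDiffAt hw hd) L.symm.contDiff.contDiffAt)
  refine h1.contDiffWithinAt.congr (fun z hz => trans_eq s s' hz.2) (trans_eq s s' ⟨y, rfl⟩)

theorem boundary_eq : (𝓡∂ 2).boundary D = {z : D | ‖(z : ℂ)‖ = 1} := by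
  have key (s : Circle) (z : D) (hz : (s : ℂ) * z ≠ 1) :
      (𝓡∂ 2) (chart s z) ∈ frontier (Set.range (𝓡∂ 2)) ↔ ‖(z : ℂ)‖ = 1 := by
    rw [frontier_range_modelWithCornersEuclideanHalfSpace]
    change 0 = L _ 0 ↔ _
    rw [L_zero, cayley_re, norm_smul]
    have : ‖1 - (s : ℂ) * z‖ ^ 2 ≠ 0 := by
      simpa [sub_eq_zero] using Ne.symm hz
    rw [eq_comm, div_eq_zero_iff, or_iff_left this, sub_eq_zero, eq_comm, pow_eq_one_iff_of_nonneg (norm_nonneg _) two_ne_zero]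
  ext z
  change _ ∈ frontier _ ↔ _
  have hz := mem_chart_source (EuclideanHalfSpace 2) z
  obtain ⟨s, hs⟩ := chart_mem_atlas (EuclideanHalfSpace 2) z
  simp only [extChartAt, OpenPartialHomeomorph.extend, PartialEquiv.coe_trans, Function.comp_apply]
  rw [← hs] at hz ⊢
  exact key s z hz

end Disk

namespace Disk

open SingularRel

/-- The boundary labels of the disk: a point `z` of the unit circle is in `S₊`, `Λ`, `S₋` according
as the real part of `(-z)^(p+1)` is positive, zero, negative. So `S₊` consists of `p + 1` equally
spaced intervals, one of them around `-1`. -/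
def height (p : ℕ) (z : D) : ℝ := ((-(z : ℂ)) ^ (p + 1)).re

theorem continuous_height (p : ℕ) : Continuous (height p) := by
  unfold height; fun_prop

/-- The unit circle. -/
def circ : Set D := {z | ‖(z : ℂ)‖ = 1}
/-- The sutures `Λ`. -/
def sutures (p : ℕ) : Set D := {z | ‖(z : ℂ)‖ = 1 ∧ height p z = 0}
/-- `S₊`. -/
def plus (p : ℕ) : Set D := {z | ‖(z : ℂ)‖ = 1 ∧ 0 < height p z}
/-- `S₋`. -/
def minus (p : ℕ) : Set D := {z | ‖(z : ℂ)‖ = 1 ∧ height p z < 0}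

theorem norm_pow_eq (p : ℕ) {z : D} (hz : ‖(z : ℂ)‖ = 1) : ‖(-(z : ℂ)) ^ (p + 1)‖ = 1 := by
  rw [norm_pow, norm_neg, hz, one_pow]

theorem pow_of_mem_sutures (p : ℕ) {z : D} (hz : z ∈ sutures p) :
    ∃ c : ℝ, (c = 1 ∨ c = -1) ∧ (-(z : ℂ)) ^ (p + 1) = c * Complex.I := by
  have h1 := norm_pow_eq p hz.1
  have h2 : ((-(z : ℂ)) ^ (p + 1)).re = 0 := hz.2
  set w := (-(z : ℂ)) ^ (p + 1)
  refine ⟨w.im, ?_, ?_⟩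
  · have := Complex.sq_norm_sub_sq_re w
    rw [h1, h2] at this
    have h3 : w.im ^ 2 = 1 := by linarith
    rcases mul_eq_zero.1 (show (w.im - 1) * (w.im + 1) = 0 by linarith) with h | h
    · exact Or.inl (by linarith)
    · exact Or.inr (by linarith)
  · apply Complex.ext <;> simp [h2]

theorem sutures_finite (p : ℕ) : (sutures p).Finite := by
  have hne : (Polynomial.X ^ (2 * (p + 1)) - Polynomial.C (-1 : ℂ)) ≠ 0 :=
    Polynomial.X_pow_sub_C_ne_zero (by omega) _
  have hfin := (Polynomial.X ^ (2 * (p + 1)) - Polynomial.C (-1 : ℂ)).rootSet_finite ℂ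
  refine Set.Finite.of_finite_image (f := fun z : D => -(z : ℂ)) (hfin.subset ?_)
    (fun a _ b _ h => Subtype.ext (neg_injective h))
  rintro _ ⟨z, hz, rfl⟩
  rw [Polynomial.mem_rootSet]
  refine ⟨hne, ?_⟩
  obtain ⟨c, hc, h⟩ := pow_of_mem_sutures p hz
  simp only [map_sub, map_pow, Polynomial.aeval_X, Polynomial.aeval_C]
  rw [mul_comm 2, pow_mul, h, mul_pow, Complex.I_sq]
  rcases hc with rfl | rfl <;> simp

/-- The point `exp (i t)`. -/
def circPt (t : ℝ) : D := ⟨Complex.exp (t * Complex.I), by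
  rw [mem_closedBall_zero_iff, Complex.norm_exp_ofReal_mul_I]⟩

theorem continuous_circPt : Continuous circPt := by
  unfold circPt; fun_prop

theorem circ_isPreconnected : IsPreconnected circ := by
  have : circ = Set.range circPt := by
    ext z
    constructor
    · intro hz
      obtain ⟨t, ht⟩ := (Complex.norm_eq_one_iff _).1 hz
      exact ⟨t, Subtype.ext ht⟩
    · rintro ⟨t, rfl⟩
      exact Complex.norm_exp_ofReal_mul_I t
  rw [this]
  exact isPreconnected_range continuous_circPt

/-- Complex conjugation. -/
def conj (z : D) : D := ⟨(starRingEnd ℂ) z, by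
  rw [mem_closedBall_zero_iff, Complex.norm_conj]; exact D_norm_le z⟩

theorem sutures_even (p : ℕ) : Even (sutures p).ncard := by
  classical
  have hfin := sutures_finite p
  rw [Set.ncard_eq_toFinset_card _ hfin]
  have : ∑ _z ∈ hfin.toFinset, (1 : ZMod 2) = 0 := by
    refine Finset.sum_involution (fun z _ => conj z) (fun _ _ => by decide) ?_ ?_ ?_
    · intro z hz _ h
      obtain ⟨c, hc, h2⟩ := pow_of_mem_sutures p (hfin.mem_toFinset.1 hz)
      have h3 : (starRingEnd ℂ) (z : ℂ) = z := congrArg Subtype.val h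
      have h4 : (starRingEnd ℂ) ((-(z : ℂ)) ^ (p + 1)) = (-(z : ℂ)) ^ (p + 1) := by
        rw [map_pow, map_neg, h3]
      rw [h2] at h4
      have := congrArg Complex.im h4
      simp at this
      rcases hc with rfl | rfl <;> norm_num at this
    · intro z hz
      rw [hfin.mem_toFinset] at hz ⊢
      refine ⟨(Complex.norm_conj _).trans hz.1, ?_⟩
      have h2 : ((-(z : ℂ)) ^ (p + 1)).re = 0 := hz.2
      change ((-((starRingEnd ℂ) (z : ℂ))) ^ (p + 1)).re = 0
      rw [← map_neg, ← map_pow, Complex.conj_re, h2]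
    · intro z _
      exact Subtype.ext (Complex.conj_conj _)
  rw [Finset.sum_const, nsmul_eq_mul, mul_one] at this
  exact (ZMod.natCast_eq_zero_iff_even).1 this

theorem plus_union_minus (p : ℕ) : plus p ∪ minus p = circ \ sutures p := by
  ext z
  simp only [plus, minus, circ, sutures, Set.mem_union, Set.mem_ofPred_eq, Set.mem_sdiff, not_and]
  constructor
  · rintro (⟨h, h'⟩ | ⟨h, h'⟩)
    · exact ⟨h, fun _ => h'.ne'⟩
    · exact ⟨h, fun _ => h'.ne⟩
  · rintro ⟨h, h'⟩
    rcases lt_or_gt_of_ne (h' h) with h2 | h2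
    · exact Or.inr ⟨h, h2⟩
    · exact Or.inl ⟨h, h2⟩

theorem component_subset (p : ℕ) (x : D) (u v : Set D) (hu : IsOpen u) (hv : IsOpen v)
    (huv : Disjoint u v) (h : circ \ sutures p ⊆ u ∪ v) (hx : x ∈ u) (hx' : x ∈ circ \ sutures p) :
    connectedComponentIn (circ \ sutures p) x ⊆ u :=
  isPreconnected_connectedComponentIn.subset_left_of_subset_union hu hv huv
    ((connectedComponentIn_subset _ _).trans h) ⟨x, mem_connectedComponentIn hx', hx⟩

theorem plus_component (p : ℕ) (x : D) (hx : x ∈ plus p) :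
    connectedComponentIn (circ \ sutures p) x ⊆ plus p := by
  have hsub : circ \ sutures p ⊆ {z | 0 < height p z} ∪ {z | height p z < 0} := by
    rw [← plus_union_minus]
    exact Set.union_subset_union (fun _ h => h.2) (fun _ h => h.2)
  have := component_subset p x {z | 0 < height p z} {z | height p z < 0}
    (isOpen_lt continuous_const (continuous_height p))
    (isOpen_lt (continuous_height p) continuous_const)
    (Set.disjoint_left.2 fun z (h : 0 < height p z) (h' : height p z < 0) => lt_asymm h h') hsub hx.2
    (plus_union_minus p ▸ Or.inl hx)
  exact fun z hz => ⟨(connectedComponentIn_subset _ _ hz).1, this hz⟩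

theorem minus_component (p : ℕ) (x : D) (hx : x ∈ minus p) :
    connectedComponentIn (circ \ sutures p) x ⊆ minus p := by
  have hsub : circ \ sutures p ⊆ {z | height p z < 0} ∪ {z | 0 < height p z} := by
    rw [← plus_union_minus, Set.union_comm]
    exact Set.union_subset_union (fun _ h => h.2) (fun _ h => h.2)
  have := component_subset p x {z | height p z < 0} {z | 0 < height p z}
    (isOpen_lt (continuous_height p) continuous_const)
    (isOpen_lt continuous_const (continuous_height p))
    (Set.disjoint_left.2 fun z (h : height p z < 0) (h' : 0 < height p z) => lt_asymm h h') hsub hx.2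
    (plus_union_minus p ▸ Or.inr hx)
  exact fun z hz => ⟨(connectedComponentIn_subset _ _ hz).1, this hz⟩

/-- Rotation of the point `z` of the disk by the angle `t`. -/
def rot (z : D) (t : ℝ) : D := ⟨z * Complex.exp (t * Complex.I), by
  rw [mem_closedBall_zero_iff, norm_mul, Complex.norm_exp_ofReal_mul_I, mul_one]
  exact D_norm_le z⟩

theorem norm_rot (z : D) (t : ℝ) : ‖(rot z t : ℂ)‖ = ‖(z : ℂ)‖ := by
  change ‖(z : ℂ) * _‖ = _
  rw [norm_mul, Complex.norm_exp_ofReal_mul_I, mul_one]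

theorem height_rot (p : ℕ) (z : D) (t : ℝ) : height p (rot z t) =
    ((-(z : ℂ)) ^ (p + 1) * Complex.exp (((p + 1) * t : ℝ) * Complex.I)).re := by
  unfold height rot
  dsimp only
  rw [← neg_mul, mul_pow, ← Complex.exp_nat_mul]
  push_cast
  ring_nf

theorem mem_closure_of_rot (p : ℕ) (z : D) (T : Set D) (b : ℝ)
    (h : ∀ τ ∈ Set.Ioo (0 : ℝ) Real.pi, rot z (b * τ / (p + 1)) ∈ T) : z ∈ closure T := by
  have hc : Continuous fun τ : ℝ => rot z (b * τ / (p + 1)) := by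
    unfold rot; fun_prop
  have h0 : rot z (b * 0 / (p + 1)) = z := Subtype.ext (by simp [rot])
  have ht : Filter.Tendsto (fun τ : ℝ => rot z (b * τ / (p + 1))) (𝓝[>] 0) (𝓝 z) := by
    have := hc.tendsto 0
    rw [h0] at this
    exact this.mono_left nhdsWithin_le_nhds
  refine mem_closure_of_tendsto ht ?_
  filter_upwards [Ioo_mem_nhdsGT Real.pi_pos] with τ hτ using h τ hτ

theorem sutures_alternating (p : ℕ) (z : D) (hz : z ∈ sutures p) :
    z ∈ closure (plus p) ∧ z ∈ closure (minus p) := by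
  obtain ⟨c, hc, h⟩ := pow_of_mem_sutures p hz
  have key (b τ : ℝ) : height p (rot z (b * τ / (p + 1))) = -c * Real.sin (b * τ) := by
    rw [height_rot, h]
    have : ((p : ℝ) + 1) * (b * τ / (p + 1)) = b * τ := by field_simp
    rw [this, Complex.mul_re, Complex.exp_ofReal_mul_I_re, Complex.exp_ofReal_mul_I_im]
    simp
  constructor
  · refine mem_closure_of_rot p z _ (-c) fun τ hτ => ⟨(norm_rot z _).trans hz.1, ?_⟩
    have := Real.sin_pos_of_mem_Ioo hτ
    rw [key]
    rcases hc with rfl | rfl <;> simpa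
  · refine mem_closure_of_rot p z _ c fun τ hτ => ⟨(norm_rot z _).trans hz.1, ?_⟩
    have := Real.sin_pos_of_mem_Ioo hτ
    rw [key]
    rcases hc with rfl | rfl <;> simpa

/-- The midpoint `-exp(-2πik/(p+1))` of the `k`-th interval of `S₊`, counted clockwise from `-1`. -/
def center (p : ℕ) (k : Fin (p + 1)) : D :=
  rot ⟨-1, by simp⟩ (-(2 * Real.pi * k / (p + 1)))

theorem neg_center (p : ℕ) (k : Fin (p + 1)) : -(center p k : ℂ) =
    Complex.exp (-(2 * Real.pi * Complex.I * (k / (p + 1 : ℕ)))) := by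
  change -(-1 * Complex.exp _) = _
  rw [neg_one_mul, neg_neg]
  congr 1
  push_cast
  ring

theorem neg_center_pow (p : ℕ) (k : Fin (p + 1)) : (-(center p k : ℂ)) ^ (p + 1) = 1 := by
  rw [neg_center, ← Complex.exp_nat_mul, Complex.exp_eq_one_iff]
  refine ⟨-(k : ℤ), ?_⟩
  have : ((p : ℂ) + 1) ≠ 0 := by exact_mod_cast Nat.succ_ne_zero p
  push_cast
  field_simp

theorem center_mem (p : ℕ) (k : Fin (p + 1)) : center p k ∈ plus p := by
  refine ⟨(norm_rot _ _).trans (by simp), ?_⟩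
  unfold height
  rw [neg_center_pow]
  simp

/-- The `(p+1)`-st root of unity that labels the interval containing `z`. -/
def root (p : ℕ) (z : D) : ℂ :=
  -(z : ℂ) * Complex.exp (-(Complex.log ((-(z : ℂ)) ^ (p + 1)) / (p + 1)))

theorem root_pow (p : ℕ) {z : D} (hz : z ∈ plus p) : root p z ^ (p + 1) = 1 := by
  have hne : (-(z : ℂ)) ^ (p + 1) ≠ 0 := by
    rw [← norm_ne_zero_iff, norm_pow_eq p hz.1]; exact one_ne_zero
  have : ((p : ℂ) + 1) ≠ 0 := by exact_mod_cast Nat.succ_ne_zero p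
  unfold root
  rw [mul_pow, ← Complex.exp_nat_mul]
  push_cast
  rw [mul_neg, mul_div_cancel₀ _ this, Complex.exp_neg, Complex.exp_log hne, mul_inv_cancel₀ hne]

theorem root_center (p : ℕ) (k : Fin (p + 1)) : root p (center p k) = -(center p k : ℂ) := by
  unfold root
  rw [neg_center_pow]
  simp

theorem continuous_root (p : ℕ) : Continuous fun z : plus p => root p z := by
  unfold root
  refine Continuous.mul (by fun_prop) (Complex.continuous_exp.comp
    (((Continuous.clog (by fun_prop) ?_).div_const _).neg))
  rintro ⟨z, hz⟩
  exact Or.inl hz.2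

/-- The midpoint of the `k`-th interval, as a point of `S₊`. -/
def centerPt (p : ℕ) (k : Fin (p + 1)) : plus p := ⟨center p k, center_mem p k⟩

theorem root_eq_of_component (p : ℕ) (x y : plus p)
    (h : (ConnectedComponents.mk x : ConnectedComponents (plus p)) = ConnectedComponents.mk y) :
    root p x = root p y := by
  have hx : x ∈ connectedComponent y := ConnectedComponents.coe_eq_coe'.1 h
  have hpre : IsPreconnected ((fun z : plus p => root p z) '' connectedComponent y) :=
    isPreconnected_connectedComponent.image _ (continuous_root p).continuousOn
  have hfin : {w : ℂ | w ^ (p + 1) = 1}.Finite := by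
    have := (Polynomial.X ^ (p + 1) - Polynomial.C (1 : ℂ)).rootSet_finite ℂ
    refine this.subset fun w (hw : w ^ (p + 1) = 1) => ?_
    rw [Polynomial.mem_rootSet]
    exact ⟨Polynomial.X_pow_sub_C_ne_zero (by omega) _, by simp [hw]⟩
  have hsub : ((fun z : plus p => root p z) '' connectedComponent y).Finite := by
    refine hfin.subset ?_
    rintro _ ⟨z, _, rfl⟩
    exact root_pow p z.2
  exact hsub.countable.isTotallyDisconnected _ subset_rfl hpre ⟨x, hx, rfl⟩
    ⟨y, mem_connectedComponent, rfl⟩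

theorem centerPt_injective (p : ℕ) : Function.Injective fun k =>
    (ConnectedComponents.mk (centerPt p k) : ConnectedComponents (plus p)) := by
  intro k l h
  have h1 := root_eq_of_component p _ _ h
  change root p (center p k) = root p (center p l) at h1
  rw [root_center, root_center, neg_center, neg_center, Complex.exp_neg, Complex.exp_neg,
    inv_inj] at h1
  have hprim := Complex.isPrimitiveRoot_exp (p + 1) (by omega)
  have h2 (j : Fin (p + 1)) : Complex.exp (2 * Real.pi * Complex.I * (j / (p + 1 : ℕ))) =
      Complex.exp (2 * Real.pi * Complex.I / (p + 1 : ℕ)) ^ (j : ℕ) := by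
    rw [← Complex.exp_nat_mul]
    congr 1
    ring
  rw [h2, h2] at h1
  exact Fin.ext (hprim.pow_inj k.2 l.2 h1)

theorem centerPt_surjective (p : ℕ) : Function.Surjective fun k =>
    (ConnectedComponents.mk (centerPt p k) : ConnectedComponents (plus p)) := by
  intro I
  obtain ⟨⟨z, hz⟩, rfl⟩ := ConnectedComponents.surjective_coe I
  have hprim := Complex.isPrimitiveRoot_exp (p + 1) (by omega)
  have hr := root_pow p hz
  obtain ⟨k, hk, hk'⟩ := hprim.eq_pow_of_pow_eq_one (ξ := (root p z)⁻¹)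
    (by rw [inv_pow, hr, inv_one])
  refine ⟨⟨k, hk⟩, ?_⟩
  have hroot : root p z = -(center p ⟨k, hk⟩ : ℂ) := by
    rw [neg_center, Complex.exp_neg, ← inv_inj, inv_inv, ← hk', ← Complex.exp_nat_mul]
    congr 1
    simp
    ring
  set θ := Complex.arg ((-(z : ℂ)) ^ (p + 1)) with hθ
  have hnorm := norm_pow_eq p hz.1
  have hlog : Complex.log ((-(z : ℂ)) ^ (p + 1)) = θ * Complex.I := by
    rw [Complex.log, hnorm]; simp [hθ]
  have habs : |θ| < Real.pi / 2 := Complex.abs_arg_lt_pi_div_two_iff.2 (Or.inl hz.2)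
  have hzrot : rot (center p ⟨k, hk⟩) (θ / (p + 1)) = z := by
    apply Subtype.ext
    change (center p ⟨k, hk⟩ : ℂ) * _ = z
    rw [← neg_inj, ← neg_mul, ← hroot, root, hlog, mul_assoc, ← Complex.exp_add]
    have : -((θ : ℂ) * Complex.I / (p + 1)) + ((θ / (p + 1) : ℝ) : ℂ) * Complex.I = 0 := by
      push_cast; ring
    rw [this, Complex.exp_zero, mul_one]
  have hmem (t : Set.Icc (0 : ℝ) 1) : rot (center p ⟨k, hk⟩) (t * θ / (p + 1)) ∈ plus p := by
    refine ⟨(norm_rot _ _).trans (center_mem p _).1, ?_⟩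
    rw [height_rot, neg_center_pow, one_mul]
    have h1 : ((p : ℝ) + 1) * (t * θ / (p + 1)) = t * θ := by field_simp
    rw [h1, Complex.exp_ofReal_mul_I_re]
    apply Real.cos_pos_of_mem_Ioo
    have h2 : |(t : ℝ) * θ| ≤ |θ| := by
      rw [abs_mul, abs_of_nonneg t.2.1]
      exact mul_le_of_le_one_left (abs_nonneg _) t.2.2
    exact abs_lt.1 (h2.trans_lt habs)
  have hcont : Continuous fun t : Set.Icc (0 : ℝ) 1 =>
      (⟨rot (center p ⟨k, hk⟩) (t * θ / (p + 1)), hmem t⟩ : plus p) := by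
    unfold rot; fun_prop
  have hpre := isPreconnected_range hcont
  refine ConnectedComponents.coe_eq_coe'.2 (hpre.subset_connectedComponent ⟨1, ?_⟩ ⟨0, ?_⟩)
  · apply Subtype.ext
    simp [hzrot]
  · apply Subtype.ext
    apply Subtype.ext
    simp [rot, centerPt]

end Disk

/-- The open `p`-tuple of pants: a disk with `p + 1` intervals of `S₊` on its boundary. The outgoing
interval is on the left, around `-1`; the `p` incoming intervals follow in clockwise order, that is,
from top to bottom when they are moved to the right side. -/
def openPants (p : ℕ) : SuturedSurface.{0} p 1 where
  carrier := Disk.D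
  oriented := by
    rintro _ ⟨s, rfl⟩ _ ⟨s', rfl⟩ x hx
    exact Disk.chart_oriented s s' x hx
  Λ := Disk.sutures p
  Splus := Disk.plus p
  Sminus := Disk.minus p
  Λ_subset := by
    rw [Disk.boundary_eq]; exact fun z hz => hz.1
  Λ_finite := Disk.sutures_finite p
  Λ_even := by
    intro x hx
    rw [Disk.boundary_eq] at hx ⊢
    change Even (Disk.sutures p ∩ connectedComponentIn Disk.circ x).ncard
    rw [Disk.circ_isPreconnected.connectedComponentIn hx,
      Set.inter_eq_left.2 (fun z hz => hz.1)]
    exact Disk.sutures_even p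
  disjoint := Set.disjoint_left.2 fun z h h' => lt_asymm h.2 h'.2
  union := by rw [Disk.boundary_eq]; exact Disk.plus_union_minus p
  plus_component := by rw [Disk.boundary_eq]; exact Disk.plus_component p
  minus_component := by rw [Disk.boundary_eq]; exact Disk.minus_component p
  alternating := Disk.sutures_alternating p
  inc i := ConnectedComponents.mk (Disk.centerPt p i.succ)
  out _ := ConnectedComponents.mk (Disk.centerPt p 0)
  label_bijective := by
    have hi := Disk.centerPt_injective p
    refine ⟨?_, fun I => ?_⟩
    · rintro (i | i) (j | j) h
      · exact congrArg Sum.inl (Fin.succ_injective _ (hi h))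
      · exact absurd (hi h) (Fin.succ_ne_zero i)
      · exact absurd (hi h).symm (Fin.succ_ne_zero j)
      · exact congrArg Sum.inr (Subsingleton.elim i j)
    · obtain ⟨k, hk⟩ := Disk.centerPt_surjective p I
      refine Fin.cases (fun hk => ⟨Sum.inr 0, hk⟩) (fun j hk => ⟨Sum.inl j, hk⟩) k hk

/-- `P` is an open `p`-tuple of pants. -/
def SuturedSurface.IsOpenPants {p : ℕ} (P : SuturedSurface.{u} p 1) : Prop :=
  Nonempty (SuturedSurface.Iso P (openPants p))

/-- For each `i`, an arc joining the outgoing interval to the `i`-th incoming interval. -/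
structure PantsArcs {p : ℕ} (P : SuturedSurface.{u} p 1) where
  left : Fin p → P.carrier
  right : Fin p → P.carrier
  left_mem : ∀ i, left i ∈ SingularRel.componentSet (P.out 0)
  right_mem : ∀ i, right i ∈ SingularRel.componentSet (P.inc i)
  arc : ∀ i, Path (left i) (right i)

namespace PantsArcs

variable (R : Type) [CommRing R] {p : ℕ} {P : SuturedSurface.{u} p 1} (γ : PantsArcs P)

/-- The classes `e_1, …, e_p` (written `e 0, …, e (p-1)`) of the arcs, with alternating orientations:
`e_p` points from the outgoing to the incoming boundary, `e_{p-1}` from the incoming to the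
outgoing boundary, and so forth. -/
def e (i : Fin p) : P.H R :=
  if Even (p - ((i : ℕ) + 1)) then
    SingularRel.arcClass R (γ.arc i) (γ.left_mem i).1 (γ.right_mem i).1
  else
    SingularRel.arcClass R (γ.arc i).symm (γ.right_mem i).1 (γ.left_mem i).1

/-- The classes `e_i` form a basis of `H_1(P, S₊; R)`. -/
def IsBasis : Prop := LinearIndependent R (γ.e R) ∧ Submodule.span R (Set.range (γ.e R)) = ⊤

/-- The wedge product of the `e_i`, `i ∈ s`, in increasing order of `i`. -/
def wedge (s : Finset (Fin p)) : ExteriorAlgebra R (P.H R) :=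
  ((s.sort (· ≤ ·)).map fun i => ExteriorAlgebra.ι R (γ.e R i)).prod

end PantsArcs

end

noncomputable section

/-! The topological input is that a disk is contractible and that each component of `S₊` is path
connected. Coning off from the origin shows that a relative 1-cycle whose boundary has total
coefficient zero on every component of `S₊` is a relative boundary (`eq_zero_of_dualClass`). The
functionals `φ` of all components of `S₊` add up to zero (`sum_dualClass`), because a boundary of a
1-chain has augmentation zero. Hence those of the incoming components already separate classes, and
that of the outgoing component is minus their sum. As the incoming functionals pair with the `e i`
by a diagonal matrix of signs (`φ_inc_e`), the `e i` form a basis (`isBasis`).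

The algebraic input is that the top element `ε ⊗ e_1 ∧ ⋯ ∧ e_p` freely generates the right module.
Let `E_{j_1} ⋯ E_{j_r}` act on it with increasing indices. When `E_j` acts, the factors to the right
of `e_j` are still all present, so the right contraction moves past `p - j` of them (counting from
1); this sign is cancelled by the value `(-1)^(p-j)` of `φ_j` on `e_j`, which is the reason for the
alternating orientations of the arcs. The result is the wedge of the remaining `e_i` without a sign
(`orbitMap_prodE`). The isomorphism is the inverse of `x ↦ top · x`, so it is right linear by
construction.

Left and right contractions commute, so left linearity needs a check on the top element only. There
a left and a right contraction by the same functional differ by the sign `-(-1)^p`. The factor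
`(-1)^π` with `π = p` and the minus sign in `φ_out = -∑ φ_j` absorb it, and `E` acts on the top
element as `∑ E_j`, the iterated coproduct of `E` (`bimoduleEquiv_outOp`).

Finally `h = p`, and the counts `a_-`, `c`, `o` vanish for a disk with this boundary pattern, so for
`A_1 = 1`, `N_3 = 0` the shifts are `δ = -p` and `π = p`. A wedge of `k` classes then has degree `k
- p`, as does the complementary monomial. All of this works over any commutative ring `R`; only the
final theorem specializes to `ℤ`. -/

/-! ### Sorted lists of finite sets, and components of joined points -/

theorem Finset.sort_eq_append {p : ℕ} (s : Finset (Fin p)) (j : Fin p) (hj : j ∈ s) :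
    s.sort (· ≤ ·) = (s.filter (· < j)).sort (· ≤ ·) ++ j :: (s.filter (j < ·)).sort (· ≤ ·) := by
  refine (Finset.sortedLT_sort s).eq_of_mem_iff ?_ fun i => ?_
  · refine List.Pairwise.sortedLT (List.pairwise_append.2 ⟨(Finset.sortedLT_sort _).pairwise,
      List.pairwise_cons.2 ⟨?_, (Finset.sortedLT_sort _).pairwise⟩, ?_⟩)
    · simp
    · simp only [Finset.mem_sort, Finset.mem_filter, List.mem_cons]
      rintro a ⟨_, ha⟩ b (rfl | ⟨_, hb⟩)
      · exact ha
      · exact ha.trans hb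
  · simp only [Finset.mem_sort, Finset.mem_filter, List.mem_cons, List.mem_append]
    have := lt_trichotomy i j
    constructor
    · tauto
    · rintro (h | rfl | h)
      exacts [h.1, hj, h.1]

theorem Finset.sort_erase {p : ℕ} (s : Finset (Fin p)) (j : Fin p) :
    (s.erase j).sort (· ≤ ·) =
      (s.filter (· < j)).sort (· ≤ ·) ++ (s.filter (j < ·)).sort (· ≤ ·) := by
  refine (Finset.sortedLT_sort _).eq_of_mem_iff ?_ fun i => ?_
  · refine List.Pairwise.sortedLT (List.pairwise_append.2 ⟨(Finset.sortedLT_sort _).pairwise,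
      (Finset.sortedLT_sort _).pairwise, ?_⟩)
    simp only [Finset.mem_sort, Finset.mem_filter]
    rintro a ⟨_, ha⟩ b ⟨_, hb⟩
    exact ha.trans hb
  · simp only [Finset.mem_sort, Finset.mem_filter, List.mem_append, Finset.mem_erase]
    rw [← and_or_left, ← lt_or_lt_iff_ne, and_comm]

theorem ConnectedComponents.mk_eq_of_joined {Y : Type*} [TopologicalSpace Y] {x y : Y}
    (h : Joined x y) :
    (ConnectedComponents.mk x : ConnectedComponents Y) = ConnectedComponents.mk y := by
  obtain ⟨γ⟩ := h
  exact ConnectedComponents.coe_eq_coe'.2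
    ((isPreconnected_range γ.continuous).subset_connectedComponent ⟨1, γ.target⟩ ⟨0, γ.source⟩)

namespace Fin

theorem sort_map_succ {p : ℕ} (s : Finset (Fin p)) :
    (s.map (Fin.succEmb p)).sort (· ≤ ·) = (s.sort (· ≤ ·)).map Fin.succ :=
  (Finset.map_sort (r := (· ≤ ·)) (r' := (· ≤ ·)) (Fin.succEmb p) s
    (fun _ _ _ _ => Fin.succ_le_succ_iff.symm)).symm

theorem sort_insert_zero_map_succ {p : ℕ} (s : Finset (Fin p)) :
    (insert 0 (s.map (Fin.succEmb p))).sort (· ≤ ·) = 0 :: (s.sort (· ≤ ·)).map Fin.succ := by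
  rw [Finset.sort_insert (· ≤ ·) (fun b _ => Fin.zero_le b) (by simp [Fin.succ_ne_zero]),
    sort_map_succ]

end Fin

/-! ### Monomials, grading and iterated coproduct in the super tensor power -/

namespace GrAlg
variable {R : Type} [CommRing R]

theorem E_succ (p : ℕ) (i : Fin p) : E R (p + 1) i.succ =
    GradedTensorProduct.includeRight (dualGr R) (dualPow R p).gr (E R p i) := rfl

theorem prodE_map_succ (p : ℕ) (s : Finset (Fin p)) :
    prodE R (p + 1) (s.map (Fin.succEmb p)) =
      GradedTensorProduct.includeRight (dualGr R) (dualPow R p).gr (prodE R p s) := by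
  rw [prodE, Fin.sort_map_succ, List.map_map, prodE, map_list_prod, List.map_map]
  rfl

theorem prodE_insert_zero_map_succ (p : ℕ) (s : Finset (Fin p)) :
    prodE R (p + 1) (insert 0 (s.map (Fin.succEmb p))) =
      GradedTensorProduct.includeLeft (dualGr R) (dualPow R p).gr DualNumber.eps *
      GradedTensorProduct.includeRight (dualGr R) (dualPow R p).gr (prodE R p s) := by
  rw [← prodE_map_succ, prodE, Fin.sort_insert_zero_map_succ, List.map_cons, List.prod_cons, prodE,
    Fin.sort_map_succ]
  rfl

/-- Peeling off the first tensor factor, which is spanned by `1` and `E`. Spanning is all that is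
needed here: the linear independence of the monomials is a by-product of `orbitMap_bijective`. -/
theorem span_prodE (p : ℕ) : Submodule.span R (Set.range (prodE R p)) = ⊤ := by
  induction p with
  | zero =>
    refine eq_top_iff.2 fun (x : R) _ => ?_
    have h : x • prodE R 0 ∅ = x := by
      rw [prodE, Finset.sort_empty]
      exact mul_one x
    rw [← h]
    exact Submodule.smul_mem _ x (Submodule.subset_span ⟨∅, rfl⟩)
  | succ p ih =>
    set T : Submodule R (dualGr R ᵍ⊗[R] (dualPow R p).gr) :=
      Submodule.span R (Set.range (prodE R (p + 1))) with hT
    let f (a : DualNumber R) : (dualPow R p).carrier →ₗ[R] dualGr R ᵍ⊗[R] (dualPow R p).gr :=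
      (GradedTensorProduct.of R (dualGr R) (dualPow R p).gr).toLinearMap ∘ₗ TensorProduct.mk R _ _ a
    have hspan (a : DualNumber R) (ha : ∀ s, f a (prodE R p s) ∈ T)
        (b : (dualPow R p).carrier) : f a b ∈ T := by
      have h : Submodule.span R (Set.range (prodE R p)) ≤ T.comap (f a) := by
        rw [Submodule.span_le]
        rintro _ ⟨s, rfl⟩
        exact ha s
      exact h (ih ▸ Submodule.mem_top)
    have h1 := hspan 1 fun s => Submodule.subset_span ⟨_, prodE_map_succ p s⟩
    have h2 := hspan DualNumber.eps fun s =>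
      Submodule.subset_span ⟨_, (prodE_insert_zero_map_succ p s).trans
        (GradedTensorProduct.tmul_one_mul_one_tmul (dualGr R) (dualPow R p).gr _ _)⟩
    have key (a : DualNumber R) (b : (dualPow R p).carrier) : f a b ∈ T := by
      have ha : f a b = a.fst • f 1 b + a.snd • f DualNumber.eps b := by
        have : a = a.fst • 1 + a.snd • DualNumber.eps := by ext <;> simp
        conv_lhs => rw [this]
        simp only [f, map_add, map_smul, LinearMap.comp_apply, LinearMap.add_apply,
          LinearMap.smul_apply]
      rw [ha]
      exact add_mem (Submodule.smul_mem _ _ (h1 b)) (Submodule.smul_mem _ _ (h2 b))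
    refine eq_top_iff.2 fun (x : dualGr R ᵍ⊗[R] (dualPow R p).gr) _ => ?_
    change x ∈ T
    obtain ⟨x, rfl⟩ := (GradedTensorProduct.of R (dualGr R) (dualPow R p).gr).surjective x
    induction x using TensorProduct.induction_on with
    | zero => rw [map_zero]; exact zero_mem _
    | add x y hx hy => rw [map_add]; exact add_mem (hx trivial) (hy trivial)
    | tmul a b => exact key a b

theorem E_mem (p : ℕ) (i : Fin p) : E R p i ∈ (dualPow R p).gr (-1) := by
  induction p with
  | zero => exact i.elim0
  | succ p ih =>
    refine Fin.cases ?_ (fun j => ?_) i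
    · exact tmul_mem_tensorGr (dualGr R) (dualPow R p).gr (add_zero (-1)) eps_mem_dualGr
        SetLike.GradedOne.one_mem
    · exact tmul_mem_tensorGr (dualGr R) (dualPow R p).gr (zero_add (-1))
        SetLike.GradedOne.one_mem (ih j)

theorem prodE_mem (p : ℕ) (s : Finset (Fin p)) :
    prodE R p s ∈ (dualPow R p).gr (-(s.card : ℤ)) := by
  have key (l : List (Fin p)) : (l.map (E R p)).prod ∈ (dualPow R p).gr (-(l.length : ℤ)) := by
    induction l with
    | nil => simpa using SetLike.GradedOne.one_mem (A := (dualPow R p).gr)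
    | cons i l ih =>
      rw [List.map_cons, List.prod_cons]
      have := SetLike.GradedMul.mul_mem (E_mem (R := R) p i) ih
      convert this using 2
      push_cast [List.length_cons]
      ring
  have := key (s.sort (· ≤ ·))
  rwa [Finset.length_sort] at this

/-- If homogeneous elements `x s` of degree `f s` span, then the part of degree `n` is spanned by
those of degree `n`. -/
theorem gr_eq_span (B : GrAlg R) {ι : Type*} (x : ι → B.carrier) (f : ι → ℤ)
    (hx : ∀ s, x s ∈ B.gr (f s)) (hspan : Submodule.span R (Set.range x) = ⊤) (n : ℤ) :
    B.gr n = Submodule.span R (x '' {s | f s = n}) := by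
  apply le_antisymm
  · intro y hy
    -- The projection to degree `n` fixes the generators of degree `n` and kills all others.
    have h : ∀ z ∈ Submodule.span R (Set.range x),
        GradedAlgebra.proj B.gr n z ∈ Submodule.span R (x '' {s | f s = n}) := by
      intro z hz
      induction hz using Submodule.span_induction with
      | zero => simp
      | add a b _ _ ha hb => rw [map_add]; exact add_mem ha hb
      | smul r a _ ha => rw [map_smul]; exact Submodule.smul_mem _ _ ha
      | mem z hz =>
        obtain ⟨s, rfl⟩ := hz
        rw [GradedAlgebra.proj_apply]
        by_cases hs : f s = n
        · subst hs
          rw [DirectSum.decompose_of_mem_same _ (hx s)]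
          exact Submodule.subset_span ⟨s, rfl, rfl⟩
        · rw [DirectSum.decompose_of_mem_ne _ (hx s) hs]
          exact zero_mem _
    have := h y (hspan ▸ Submodule.mem_top)
    rwa [GradedAlgebra.proj_apply, DirectSum.decompose_of_mem_same _ hy] at this
  · rw [Submodule.span_le]
    rintro _ ⟨s, rfl, rfl⟩
    exact hx s

/-- Monomials are homogeneous and span. The sign of the degree `-s.card` is kept in `ℚ` and is
immaterial modulo 2. -/
theorem superGr_dualPow (p : ℕ) (q : ℚ) (a : ZMod 2) : (dualPow R p).superGr q a =
    Submodule.span R (prodE R p ''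
      {s | -(s.card : ℚ) = q ∧ (s.card : ZMod 2) = a}) := by
  unfold superGr
  simp_rw [gr_eq_span (dualPow R p) (prodE R p) _ (prodE_mem p) (span_prodE p),
    ← Submodule.span_iUnion, ← Set.image_iUnion]
  congr 2
  ext s
  simp only [Set.mem_iUnion, Set.mem_ofPred_eq, exists_prop]
  constructor
  · rintro ⟨_, ⟨rfl, rfl⟩, rfl⟩
    simp
  · rintro ⟨rfl, rfl⟩
    exact ⟨_, ⟨by simp, by simp⟩, rfl⟩

theorem iterCoproduct_succ (p : ℕ) (a : DualNumber R) : iterCoproduct (p + 1) a =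
    GradedTensorProduct.of R (dualGr R) (dualPow R p).gr
      (TensorProduct.map LinearMap.id (iterCoproduct p)
        ((GradedTensorProduct.of R (dualGr R) (dualGr R)).symm (coproduct a))) := rfl

/-- `iterCoproduct` is defined as a linear map only, so its values on the spanning elements `1` and
`E` are computed separately. The value at `1` also enters the term `E ⊗ 1` in the recursion for `E`.
-/
theorem iterCoproduct_one (p : ℕ) : iterCoproduct (R := R) p 1 = 1 := by
  induction p with
  | zero => rfl
  | succ p ih =>
    rw [iterCoproduct_succ, map_one]
    change GradedTensorProduct.of R (dualGr R) (dualPow R p).gr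
      (TensorProduct.map LinearMap.id (iterCoproduct p) (1 ⊗ₜ 1)) = _
    rw [TensorProduct.map_tmul, ih]
    rfl

theorem iterCoproduct_eps (p : ℕ) :
    iterCoproduct (R := R) p DualNumber.eps = ∑ i, E R p i := by
  induction p with
  | zero => rfl
  | succ p ih =>
    rw [Fin.sum_univ_succ, iterCoproduct_succ, coproduct, dualLift_eps]
    change GradedTensorProduct.of R (dualGr R) (dualPow R p).gr
      (TensorProduct.map LinearMap.id (iterCoproduct p)
        (DualNumber.eps ⊗ₜ 1 + 1 ⊗ₜ DualNumber.eps)) = _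
    rw [map_add, TensorProduct.map_tmul, TensorProduct.map_tmul, ih, iterCoproduct_one, map_add]
    simp_rw [E_succ]
    erw [← map_sum]
    rfl

end GrAlg

/-! ### Left and right contractions of the exterior algebra -/

namespace ExteriorAlgebra

variable {R : Type*} [CommRing R] {M : Type*} [AddCommGroup M] [Module R M]

theorem involute_ιMulti (j : ℕ) (v : Fin j → M) :
    CliffordAlgebra.involute (Q := (0 : QuadraticForm R M)) (ιMulti R j v) =
      (-1 : R) ^ j • ιMulti R j v := by
  have := CliffordAlgebra.involute_prod_map_ι (Q := (0 : QuadraticForm R M)) (List.ofFn v)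
  rw [List.length_ofFn, List.map_ofFn] at this
  exact this

/-- Contraction lowers the degree by one, so it is odd for the parity involution. -/
theorem involute_contractLeft (d : Module.Dual R M)
    (x : CliffordAlgebra (0 : QuadraticForm R M)) :
    CliffordAlgebra.involute (CliffordAlgebra.contractLeft d x) =
      -CliffordAlgebra.contractLeft d (CliffordAlgebra.involute x) := by
  induction x using CliffordAlgebra.left_induction with
  | algebraMap r => simp
  | add x y hx hy => simp only [map_add, hx, hy, neg_add]
  | ι_mul x m hx =>
    simp only [map_sub, map_smul, map_mul, CliffordAlgebra.contractLeft_ι_mul, hx,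
      CliffordAlgebra.involute_ι, neg_mul, map_neg, mul_neg]
    abel

end ExteriorAlgebra

namespace ShiftedExt

variable {R : Type} [CommRing R] {M : Type u} [AddCommGroup M] [Module R M]

/-- On a product of `j + 1` vectors, the `i`-th terms of the two contractions carry the signs
`(-1)^(j-i)` and `(-1)^i`, whose ratio `(-1)^j` does not depend on `i`. The involution contributes
`(-1)^(j+1)`, hence the extra minus sign. Through this formula facts about right contractions reduce
to left ones. -/
theorem contractRight_eq_neg_contractLeft (d : Module.Dual R M) (x : ExteriorAlgebra R M) :
    CliffordAlgebra.contractRight (Q := (0 : QuadraticForm R M)) x d =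
      -CliffordAlgebra.contractLeft (Q := (0 : QuadraticForm R M)) d
        (CliffordAlgebra.involute (Q := (0 : QuadraticForm R M)) x) := by
  have hx : x ∈ Submodule.span R (Set.range fun x : Σ n, (Fin n → M) =>
      ExteriorAlgebra.ιMulti R x.1 x.2) := by
    rw [ExteriorAlgebra.ιMulti_span]; trivial
  induction hx using Submodule.span_induction with
  | zero => simp
  | add x y _ _ hx hy => rw [map_add, LinearMap.add_apply, hx, hy, map_add, map_add, neg_add]
  | smul r x _ hx => rw [map_smul, LinearMap.smul_apply, hx, map_smul, map_smul, smul_neg]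
  | mem x hx =>
    obtain ⟨⟨j, v⟩, rfl⟩ := hx
    dsimp only
    cases j with
    | zero =>
      rw [ExteriorAlgebra.ιMulti_zero_apply, map_one CliffordAlgebra.involute,
        CliffordAlgebra.contractLeft_one, neg_zero]
      exact CliffordAlgebra.contractRight_one _ _
    | succ j =>
      rw [ExteriorAlgebra.involute_ιMulti, map_smul, contractLeft_ιMulti, contractRight_ιMulti,
        Finset.smul_sum, ← Finset.sum_neg_distrib]
      refine Finset.sum_congr rfl fun i _ => ?_
      rw [smul_smul, ← neg_smul]
      congr 1
      -- The truncated subtraction is genuine, because `i ≤ j`.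
      have hi : (j - (i : ℕ)) + i = j := by omega
      have h2 : (-1 : R) ^ (i : ℕ) * (-1) ^ (i : ℕ) = 1 := by
        rw [← mul_pow]; simp
      calc (-1 : R) ^ (j - (i : ℕ)) * d (v i)
          = (-1 : R) ^ (j - (i : ℕ)) * ((-1) ^ (i : ℕ) * (-1) ^ (i : ℕ)) * d (v i) := by
            rw [h2, mul_one]
        _ = _ := by rw [← mul_assoc, ← pow_add, hi, pow_succ]; ring

/-- Two left contractions anticommute; moving the involution past one of them gives a second sign,
and the two cancel. -/
theorem contractLeft_contractRight (d d' : Module.Dual R M) (x : ExteriorAlgebra R M) :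
    CliffordAlgebra.contractLeft (Q := (0 : QuadraticForm R M)) d
        (CliffordAlgebra.contractRight (Q := (0 : QuadraticForm R M)) x d') =
      CliffordAlgebra.contractRight (Q := (0 : QuadraticForm R M))
        (CliffordAlgebra.contractLeft (Q := (0 : QuadraticForm R M)) d x) d' := by
  rw [contractRight_eq_neg_contractLeft, contractRight_eq_neg_contractLeft,
    ExteriorAlgebra.involute_contractLeft, map_neg, map_neg, CliffordAlgebra.contractLeft_comm]

/-- This is the bimodule axiom. The operators commute strictly, although both are odd, since they
act from opposite sides; the prefactor enters `outOp` only through a scalar. -/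
theorem commute_outOp_inOp (k : ℕ) (d d' : Module.Dual R M) :
    Commute (outOp R k d) (inOp R k d') := by
  refine TensorProduct.ext' fun a w => ?_
  simp [outOp, inOp, contractLeft_contractRight]

/-- The right contraction enters from the right and changes sign at each factor that it passes; the
factors killed by `d` contribute no term of their own. -/
theorem contractRight_mul_prod (d : Module.Dual R M) (l : List M) (hl : ∀ v ∈ l, d v = 0)
    (x : ExteriorAlgebra R M) :
    CliffordAlgebra.contractRight (Q := (0 : QuadraticForm R M))
        (x * (l.map (ExteriorAlgebra.ι R)).prod) d =
      (-1 : R) ^ l.length •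
        (CliffordAlgebra.contractRight (Q := (0 : QuadraticForm R M)) x d *
          (l.map (ExteriorAlgebra.ι R)).prod) := by
  induction l generalizing x with
  | nil => simp
  | cons v l ih =>
    rw [List.map_cons, List.prod_cons, ← mul_assoc,
      ih (fun w hw => hl w (List.mem_cons_of_mem _ hw))]
    have h := CliffordAlgebra.contractRight_mul_ι (Q := (0 : QuadraticForm R M)) d v x
    rw [hl v List.mem_cons_self, zero_smul, zero_sub] at h
    erw [h]
    rw [List.length_cons, pow_succ, mul_neg_one, neg_smul, ← mul_assoc, neg_mul, smul_neg]

/-- The wedge product of the `e i`, `i ∈ s`, in increasing order of `i`. -/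
def wedge {p : ℕ} (e : Fin p → M) (s : Finset (Fin p)) : ExteriorAlgebra R M :=
  ((s.sort (· ≤ ·)).map fun i => ExteriorAlgebra.ι R (e i)).prod

/-- This is where the signs cancel. Since `s` contains every index from `j` on, exactly `p - (j +
1)` factors stand to the right of `e j` (indices start at 0), and passing them costs the same sign
as the value `d (e j)`. -/
theorem contractRight_wedge {p : ℕ} (e : Fin p → M) (d : Module.Dual R M) (j : Fin p)
    (hd : ∀ i, d (e i) = if i = j then (-1 : R) ^ (p - (j + 1)) else 0)
    (s : Finset (Fin p)) (hs : ∀ i, j ≤ i → i ∈ s) :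
    CliffordAlgebra.contractRight (Q := (0 : QuadraticForm R M)) (wedge e s) d =
      wedge e (s.erase j) := by
  have hcard : (s.filter (j < ·)).card = p - (j + 1) := by
    have : s.filter (j < ·) = Finset.Ioi j := by
      ext i
      simp only [Finset.mem_filter, Finset.mem_Ioi, and_iff_right_iff_imp]
      exact fun h => hs i h.le
    rw [this, Fin.card_Ioi]
    omega
  have hmap (l : List (Fin p)) : (l.map fun i => ExteriorAlgebra.ι R (e i)) =
      (l.map e).map (ExteriorAlgebra.ι R) := by
    rw [List.map_map]; rfl
  have h1 : CliffordAlgebra.contractRight (Q := (0 : QuadraticForm R M))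
      (((s.filter (· < j)).sort (· ≤ ·)).map fun i => ExteriorAlgebra.ι R (e i)).prod d = 0 := by
    -- Taking `x = 1`, whose contraction is zero: the factors to the left of `e j` contribute
    -- nothing.
    have := contractRight_mul_prod d (((s.filter (· < j)).sort (· ≤ ·)).map e) (by
      simp only [List.mem_map, Finset.mem_sort, Finset.mem_filter]
      rintro _ ⟨i, ⟨_, hi⟩, rfl⟩
      rw [hd, if_neg hi.ne]) (1 : ExteriorAlgebra R M)
    rw [one_mul] at this
    rw [hmap, this]
    erw [CliffordAlgebra.contractRight_one]
    rw [zero_mul, smul_zero]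
  unfold wedge
  rw [Finset.sort_eq_append s j (hs j le_rfl), Finset.sort_erase, List.map_append, List.map_append,
    List.prod_append, List.prod_append, List.map_cons, List.prod_cons, ← mul_assoc,
    hmap ((s.filter (j < ·)).sort (· ≤ ·)), contractRight_mul_prod, List.length_map,
    Finset.length_sort, hcard]
  -- The square of the sign `(-1)^(p-(j+1))` remains, which is `1`.
  · erw [CliffordAlgebra.contractRight_mul_ι]
    rw [h1, hd, if_pos rfl, zero_mul, sub_zero, smul_mul_assoc, smul_smul, ← mul_pow]
    simp
  · simp only [List.mem_map, Finset.mem_sort, Finset.mem_filter]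
    rintro _ ⟨i, ⟨_, hi⟩, rfl⟩
    rw [hd, if_neg hi.ne']

/-! ### Bases of the exterior algebra and of its shifts, indexed by subsets -/

theorem basis_exteriorAlgebra_apply {p : ℕ} (b : Module.Basis (Fin p) R M) (s : Finset (Fin p)) :
    b.ExteriorAlgebra s = wedge b s := by
  rw [ExteriorAlgebra.basis_apply_ofCard b rfl, ExteriorAlgebra.ιMulti_family,
    ExteriorAlgebra.ιMulti_apply, wedge, Set.powersetCard.ofFinEmbEquiv_symm_apply,
    ← Finset.listMap_orderEmbOfFin_finRange s rfl, List.map_map, List.ofFn_eq_map]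
  rfl

theorem exteriorPower_eq_span {p : ℕ} (b : Module.Basis (Fin p) R M) (j : ℕ) :
    ⋀[R]^j M = Submodule.span R (wedge b '' {s | s.card = j}) := by
  have h := congrArg (Submodule.map (⋀[R]^j M).subtype) (b.exteriorPower j).span_eq
  rw [Submodule.map_span, Submodule.map_top, Submodule.range_subtype, ← Set.range_comp] at h
  rw [← h]
  congr 1
  ext x
  constructor
  · rintro ⟨s, rfl⟩
    refine ⟨s, s.2, ?_⟩
    rw [← basis_exteriorAlgebra_apply, ExteriorAlgebra.basis_eq_coe_basis]
    rfl
  · rintro ⟨s, hs, rfl⟩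
    refine ⟨⟨s, hs⟩, ?_⟩
    rw [← basis_exteriorAlgebra_apply]
    exact (ExteriorAlgebra.basis_eq_coe_basis b ⟨s, hs⟩).symm

/-- The isomorphism `w ↦ ε ⊗ w`. -/
def pureEquiv (R : Type) [CommRing R] (k : ℕ) (M : Type u) [AddCommGroup M] [Module R M] :
    ExteriorAlgebra R M ≃ₗ[R] ShiftedExt R k M :=
  (TensorProduct.lid R _).symm ≪≫ₗ TensorProduct.congr
    (PiTensorProduct.constantBaseRingEquiv (Fin k) R).symm.toLinearEquiv (LinearEquiv.refl R _)

theorem pureEquiv_apply (k : ℕ) (w : ExteriorAlgebra R M) :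
    pureEquiv R k M w = ε R k ⊗ₜ[R] w := by
  change ((PiTensorProduct.constantBaseRingEquiv (Fin k) R).symm 1 : Prefactor R k) ⊗ₜ[R] w = _
  rw [map_one]
  rfl

/-- The prefactor is a tensor power of copies of `R`, hence of rank one for every `k`, including the
empty power. -/
theorem exists_eq_smul_ε (k : ℕ) (a : Prefactor R k) : ∃ r : R, a = r • ε R k := by
  obtain ⟨r, hr⟩ := (PiTensorProduct.constantBaseRingEquiv (Fin k) R).symm.surjective a
  refine ⟨r, hr.symm.trans ?_⟩
  rw [PiTensorProduct.constantBaseRingEquiv_symm]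
  exact Algebra.algebraMap_eq_smul_one (A := ⨂[R] _ : Fin k, R) r

/-! ### The bimodule isomorphism, for an abstract module with a basis and signed dual functionals -/

section bimodule

variable {p : ℕ} (k : ℕ) (b : Module.Basis (Fin p) R M) (d : Fin p → Module.Dual R M)

/-- The basis `ε ⊗ (e_{i_1} ∧ ⋯ ∧ e_{i_j})`. -/
def basis : Module.Basis (Finset (Fin p)) R (ShiftedExt R k M) :=
  b.ExteriorAlgebra.map (pureEquiv R k M)

theorem basis_apply (s : Finset (Fin p)) : basis k b s = ε R k ⊗ₜ[R] wedge b s := by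
  rw [basis, Module.Basis.map_apply, pureEquiv_apply, basis_exteriorAlgebra_apply]

theorem wedgePart_eq_span (j : ℕ) :
    wedgePart R k M j = Submodule.span R (basis k b '' {s | s.card = j}) := by
  have h : wedgePart R k M j = (⋀[R]^j M).map (pureEquiv R k M).toLinearMap := by
    apply le_antisymm
    · rintro _ ⟨x, rfl⟩
      induction x using TensorProduct.induction_on with
      | zero => rw [map_zero]; exact zero_mem _
      | add x y hx hy => rw [map_add]; exact add_mem hx hy
      | tmul a w =>
        obtain ⟨r, rfl⟩ := exists_eq_smul_ε k a
        refine ⟨r • w, Submodule.smul_mem _ _ w.2, ?_⟩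
        rw [LinearEquiv.coe_coe, pureEquiv_apply, TensorProduct.tmul_smul, TensorProduct.smul_tmul',
          LinearMap.lTensor_tmul]
        rfl
    · rintro _ ⟨w, hw, rfl⟩
      exact ⟨ε R k ⊗ₜ ⟨w, hw⟩, (pureEquiv_apply k w).symm⟩
  rw [h, exteriorPower_eq_span b, Submodule.map_span, ← Set.image_comp]
  congr 2
  ext s
  simp [basis_apply, pureEquiv_apply]

theorem rightAction_E (j : Fin p) (z : ShiftedExt R k M) :
    (rightAction R k d (GrAlg.E R p j)).unop z = inOp R k (d j) z := by
  rw [rightAction, GrAlg.E, GrAlg.powLift_incl]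
  rfl

theorem rightAction_mul (x y : (GrAlg.dualPow R p).carrier) (z : ShiftedExt R k M) :
    (rightAction R k d (x * y)).unop z =
      (rightAction R k d y).unop ((rightAction R k d x).unop z) := by
  rw [map_mul]
  rfl

/-- The monomials span the algebra, and each acts as a composite of operators `inOp`, so
`commute_outOp_inOp` applies factor by factor. -/
theorem commute_outOp_rightAction (d' : Module.Dual R M) (x : (GrAlg.dualPow R p).carrier)
    (z : ShiftedExt R k M) :
    outOp R k d' ((rightAction R k d x).unop z) = (rightAction R k d x).unop (outOp R k d' z) := by
  have hx : x ∈ Submodule.span R (Set.range (GrAlg.prodE R p)) := by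
    rw [GrAlg.span_prodE]; trivial
  induction hx using Submodule.span_induction with
  | zero => simp
  | add x y _ _ hx hy =>
    simp only [map_add, MulOpposite.unop_add, LinearMap.add_apply, hx, hy]
  | smul r x _ hx =>
    simp only [map_smul, MulOpposite.unop_smul, LinearMap.smul_apply, hx]
  | mem x hx =>
    obtain ⟨s, rfl⟩ := hx
    unfold GrAlg.prodE
    generalize s.sort (· ≤ ·) = l
    induction l generalizing z with
    | nil => simp
    | cons j l ih =>
      rw [List.map_cons, List.prod_cons, rightAction_mul, rightAction_mul, ih, rightAction_E,
        rightAction_E]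
      congr 1
      exact LinearMap.congr_fun (commute_outOp_inOp k d' (d j)) z

/-- The map `x ↦ (ε ⊗ (e_1 ∧ ⋯ ∧ e_p)) · x`. -/
def orbitMap : (GrAlg.dualPow R p).carrier →ₗ[R] ShiftedExt R k M where
  toFun x := (rightAction R k d x).unop (basis k b Finset.univ)
  map_add' x y := by rw [map_add]; rfl
  map_smul' r x := by rw [map_smul]; rfl

theorem orbitMap_mul (x y : (GrAlg.dualPow R p).carrier) :
    orbitMap k b d (x * y) = (rightAction R k d y).unop (orbitMap k b d x) :=
  rightAction_mul k d x y _

variable (hd : ∀ i j, d j (b i) = if i = j then (-1 : R) ^ (p - (j + 1 : ℕ)) else 0)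
include hd

theorem inOp_basis (j : Fin p) (s : Finset (Fin p)) (hs : ∀ i, j ≤ i → i ∈ s) :
    inOp R k (d j) (basis k b s) = basis k b (s.erase j) := by
  rw [basis_apply, basis_apply, inOp, LinearMap.lTensor_tmul, LinearMap.flip_apply,
    contractRight_wedge b (d j) j (fun i => hd i j) s hs]

/-- In a right action the leftmost factor acts first, so the indices are removed in increasing
order. Removing a smaller index leaves all indices from the next one on in place, as `inOp_basis`
requires. -/
theorem rightAction_prod (l : List (Fin p)) (hl : l.Pairwise (· < ·)) (s : Finset (Fin p))
    (hs : ∀ j ∈ l, ∀ i, j ≤ i → i ∈ s) :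
    (rightAction R k d (l.map (GrAlg.E R p)).prod).unop (basis k b s) =
      basis k b (s \ l.toFinset) := by
  induction l generalizing s with
  | nil => simp
  | cons j l ih =>
    rw [List.pairwise_cons] at hl
    rw [List.map_cons, List.prod_cons, rightAction_mul, rightAction_E,
      inOp_basis k b d hd j s (hs j List.mem_cons_self), ih hl.2]
    · congr 1
      ext i
      simp
      tauto
    · intro i hi a ha
      rw [Finset.mem_erase]
      exact ⟨((hl.1 i hi).trans_le ha).ne', hs i (List.mem_cons_of_mem _ hi) a ha⟩

theorem orbitMap_prodE (s : Finset (Fin p)) :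
    orbitMap k b d (GrAlg.prodE R p sᶜ) = basis k b s := by
  change (rightAction R k d (((sᶜ).sort (· ≤ ·)).map (GrAlg.E R p)).prod).unop _ = _
  rw [rightAction_prod k b d hd _ (Finset.sortedLT_sort _).pairwise _ (by simp),
    Finset.sort_toFinset]
  congr 1
  ext
  simp

/-- The linear combination map `f` on the monomials is onto, and its composite with `orbitMap` sends
the standard basis to the basis `basis k b`. An isomorphism that factors through a surjection `f`
forces the other factor to be bijective. -/
theorem orbitMap_bijective : Function.Bijective (orbitMap k b d) := by
  let f := Finsupp.linearCombination R fun s : Finset (Fin p) => GrAlg.prodE R p sᶜ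
  have hf : Function.Surjective f := by
    rw [← LinearMap.range_eq_top, Finsupp.range_linearCombination, ← GrAlg.span_prodE p]
    congr 1
    exact compl_surjective.range_comp (GrAlg.prodE R p)
  have h : orbitMap k b d ∘ₗ f = (basis k b).repr.symm.toLinearMap := by
    ext s
    simp [f, orbitMap_prodE k b d hd]
  have h' (x) : orbitMap k b d (f x) = (basis k b).repr.symm x := LinearMap.congr_fun h x
  constructor
  · intro x y hxy
    obtain ⟨x, rfl⟩ := hf x
    obtain ⟨y, rfl⟩ := hf y
    rw [h', h'] at hxy
    rw [(basis k b).repr.symm.injective hxy]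
  · intro z
    exact ⟨f ((basis k b).repr z), by rw [h', LinearEquiv.symm_apply_apply]⟩

/-- The bimodule isomorphism `ε ⊗ (e_{i_1} ∧ ⋯ ∧ e_{i_k}) ↦ E_{j_1} ⋯ E_{j_{p-k}}`. -/
def bimoduleEquiv : ShiftedExt R k M ≃ₗ[R] (GrAlg.dualPow R p).carrier :=
  (LinearEquiv.ofBijective (orbitMap k b d) (orbitMap_bijective k b d hd)).symm

theorem bimoduleEquiv_eq_iff (z : ShiftedExt R k M) (x : (GrAlg.dualPow R p).carrier) :
    bimoduleEquiv k b d hd z = x ↔ z = orbitMap k b d x :=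
  LinearEquiv.symm_apply_eq _

theorem orbitMap_bimoduleEquiv (z : ShiftedExt R k M) :
    orbitMap k b d (bimoduleEquiv k b d hd z) = z :=
  ((bimoduleEquiv_eq_iff k b d hd z _).1 rfl).symm

theorem bimoduleEquiv_basis (s : Finset (Fin p)) :
    bimoduleEquiv k b d hd (basis k b s) = GrAlg.prodE R p sᶜ := by
  rw [bimoduleEquiv_eq_iff, orbitMap_prodE k b d hd]

theorem bimoduleEquiv_rightAction (z : ShiftedExt R k M) (x : (GrAlg.dualPow R p).carrier) :
    bimoduleEquiv k b d hd ((rightAction R k d x).unop z) = bimoduleEquiv k b d hd z * x := by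
  rw [bimoduleEquiv_eq_iff, orbitMap_mul, orbitMap_bimoduleEquiv]

/-- Write `z = top · x`. As `outOp` commutes with the right action, only its value on the top
element matters, and this is `∑ j, top · E_j`. -/
theorem bimoduleEquiv_outOp (hk : (-1 : R) ^ k = (-1) ^ p) (z : ShiftedExt R k M) :
    bimoduleEquiv k b d hd (outOp R k (-∑ j, d j) z) =
      GrAlg.iterCoproduct p DualNumber.eps * bimoduleEquiv k b d hd z := by
  -- On the top element the involution is the scalar `(-1)^p`, which `hk` identifies with the sign
  -- in `outOp`. The minus sign relating the two contractions is supplied by `-d'`.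
  have h1 (d' : Module.Dual R M) : outOp R k (-d') (basis k b Finset.univ) =
      inOp R k d' (basis k b Finset.univ) := by
    have h2 : CliffordAlgebra.involute (Q := (0 : QuadraticForm R M)) (wedge b Finset.univ) =
        (-1 : R) ^ p • wedge b Finset.univ := by
      have := CliffordAlgebra.involute_prod_map_ι (Q := (0 : QuadraticForm R M))
        ((Finset.univ.sort (· ≤ ·)).map b)
      rw [List.length_map, Finset.length_sort, Finset.card_univ, Fintype.card_fin,
        List.map_map] at this
      exact this
    rw [basis_apply, inOp, outOp, LinearMap.smul_apply, LinearMap.lTensor_tmul,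
      LinearMap.lTensor_tmul, LinearMap.flip_apply, contractRight_eq_neg_contractLeft, h2, hk,
      map_smul, map_neg, LinearMap.neg_apply, ← TensorProduct.tmul_smul, smul_neg]
  rw [bimoduleEquiv_eq_iff, orbitMap_mul, GrAlg.iterCoproduct_eps, map_sum]
  have h3 (j : Fin p) : orbitMap k b d (GrAlg.E R p j) = inOp R k (d j) (basis k b Finset.univ) :=
    rightAction_E k d j _
  have h4 : ∑ j, inOp R k (d j) (basis k b Finset.univ) =
      inOp R k (∑ j, d j) (basis k b Finset.univ) := by
    simp [inOp, basis_apply, TensorProduct.tmul_sum]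
  simp_rw [h3]
  rw [h4, ← h1, ← commute_outOp_rightAction]
  congr 1
  exact (orbitMap_bimoduleEquiv k b d hd z).symm

/-- Both sides are linear in `a`, so it is enough to treat `1` and `E`. -/
theorem bimoduleEquiv_leftAction (hk : (-1 : R) ^ k = (-1) ^ p) (d' : Fin 1 → Module.Dual R M)
    (hd' : d' 0 = -∑ j, d j) (a : DualNumber R) (z : ShiftedExt R k M) :
    bimoduleEquiv k b d hd (leftAction R k d' (GrAlg.incl 1 0 a) z) =
      GrAlg.iterCoproduct p a * bimoduleEquiv k b d hd z := by
  have ha : a = a.fst • 1 + a.snd • DualNumber.eps := by ext <;> simp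
  rw [ha]
  simp only [map_add, map_smul, map_one, LinearMap.add_apply, LinearMap.smul_apply, add_mul,
    smul_mul_assoc, GrAlg.iterCoproduct_one, one_mul, Module.End.one_apply]
  rw [← bimoduleEquiv_outOp k b d hd hk, leftAction, GrAlg.powLift_incl, hd']

end bimodule

end ShiftedExt

/-! ### The cone over a singular 1-simplex of the disk -/

namespace Disk
open SingularRel

/-- The path `r ↦ σ (1 - r, r)` underlying a singular `1`-simplex, extended to all of `ℝ`. -/
def param (σ : Simplex 1 D) (r : ℝ) : ℂ :=
  σ (stdSimplexHomeomorphUnitInterval.symm (Set.projIcc 0 1 zero_le_one r))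

theorem continuous_param (σ : Simplex 1 D) : Continuous (param σ) := by
  unfold param
  have := stdSimplexHomeomorphUnitInterval.symm.continuous
  have h := continuous_projIcc (a := (0 : ℝ)) (b := 1) (h := zero_le_one)
  exact continuous_subtype_val.comp (σ.continuous.comp (this.comp h))

theorem norm_param_le (σ : Simplex 1 D) (r : ℝ) : ‖param σ r‖ ≤ 1 := D_norm_le _

theorem param_apply (σ : Simplex 1 D) (t : stdSimplex ℝ (Fin 2)) : param σ (t 1) = σ t := by
  have : Set.projIcc 0 1 zero_le_one (t 1) = stdSimplexHomeomorphUnitInterval t :=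
    Set.projIcc_of_mem zero_le_one (stdSimplexHomeomorphUnitInterval t).2
  rw [param, this, Homeomorph.symm_apply_apply]

theorem param_zero (σ : Simplex 1 D) : param σ 0 = σ (stdSimplex.vertex 0) := by
  rw [← param_apply]; simp

theorem param_one (σ : Simplex 1 D) : param σ 1 = σ (stdSimplex.vertex 1) := by
  rw [← param_apply]; simp

/-- At a zero of `s` the quotient `t / s` may be discontinuous, but `g` is bounded and the factor
`s` tends to `0`. This gives continuity of a cone at its apex. -/
theorem continuous_mul_comp_div {Y : Type*} [TopologicalSpace Y] {g : ℝ → ℂ} (hg : Continuous g)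
    (hb : ∀ r, ‖g r‖ ≤ 1) {s t : Y → ℝ} (hs : Continuous s) (ht : Continuous t) :
    Continuous fun y => (s y : ℂ) * g (t y / s y) := by
  rw [continuous_iff_continuousAt]
  intro y
  by_cases h : s y = 0
  · have h0 : Filter.Tendsto (fun y => |s y|) (𝓝 y) (𝓝 0) := by
      have := hs.abs.tendsto y
      rwa [h, abs_zero] at this
    have : Filter.Tendsto (fun y => (s y : ℂ) * g (t y / s y)) (𝓝 y) (𝓝 0) := by
      refine squeeze_zero_norm (fun z => ?_) h0
      rw [norm_mul, Complex.norm_real, Real.norm_eq_abs]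
      exact mul_le_of_le_one_right (abs_nonneg _) (hb _)
    simpa [ContinuousAt, h] using this
  · exact (Complex.continuous_ofReal.comp hs).continuousAt.mul
      (hg.continuousAt.comp (ht.continuousAt.div hs.continuousAt h))

/-- The cone from the origin over a singular `1`-simplex of the disk. -/
def cone (σ : Simplex 1 D) : Simplex 2 D where
  -- Vertex 0 is the apex and goes to the origin: there the quotient has the default value `0` and
  -- the first factor vanishes.
  toFun t := ⟨((1 - t 0 : ℝ) : ℂ) * param σ (t 2 / (1 - t 0)), by
    rw [mem_closedBall_zero_iff, norm_mul, Complex.norm_real, Real.norm_eq_abs]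
    have h0 : 0 ≤ t 0 := t.2.1 0
    have h1 : t 0 ≤ 1 := (mem_Icc_of_mem_stdSimplex t.2 0).2
    rw [abs_of_nonneg (by linarith)]
    exact mul_le_one₀ (by linarith) (norm_nonneg _) (norm_param_le _ _)⟩
  continuous_toFun := by
    have h (i : Fin 3) : Continuous fun t : stdSimplex ℝ (Fin 3) => t i :=
      (continuous_apply i).comp continuous_subtype_val
    exact (continuous_mul_comp_div (continuous_param σ) (norm_param_le σ)
      (continuous_const.sub (h 0)) (h 2)).subtype_mk _

/-- The segment from the origin to `x`. -/
def segmentTo (x : D) : Simplex 1 D where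
  toFun t := ⟨((t 1 : ℝ) : ℂ) * x, by
    rw [mem_closedBall_zero_iff, norm_mul, Complex.norm_real, Real.norm_eq_abs]
    have h := mem_Icc_of_mem_stdSimplex t.2 1
    have h0 : 0 ≤ t 1 := h.1
    rw [abs_of_nonneg h0]
    exact mul_le_one₀ h.2 (norm_nonneg _) (D_norm_le x)⟩
  continuous_toFun := by
    have h : Continuous fun t : stdSimplex ℝ (Fin 2) => t 1 :=
      (continuous_apply 1).comp continuous_subtype_val
    exact ((Complex.continuous_ofReal.comp h).mul continuous_const).subtype_mk _

theorem stdSimplex_add (t : stdSimplex ℝ (Fin 2)) : t 0 + t 1 = 1 := by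
  have := t.2.2
  rwa [Fin.sum_univ_two] at this

theorem map_succAbove (i : Fin 3) (t : stdSimplex ℝ (Fin 2)) (j : Fin 3) :
    stdSimplex.map i.succAbove t j =
      ∑ l : Fin 2, if i.succAbove l = j then t l else 0 := by
  rw [stdSimplex.map_coe, FunOnFinite.linearMap_apply_apply, Finset.sum_filter]

theorem face_cone_zero (σ : Simplex 1 D) : face 1 0 (cone σ) = σ := by
  ext t
  have h0 : stdSimplex.map (Fin.succAbove (0 : Fin 3)) t 0 = 0 := by
    rw [map_succAbove]; simp
  have h2 : stdSimplex.map (Fin.succAbove (0 : Fin 3)) t 2 = t 1 := by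
    rw [map_succAbove, Fin.sum_univ_two]; simp [Fin.ext_iff]
  change ((1 - stdSimplex.map _ t 0 : ℝ) : ℂ) *
    param σ (stdSimplex.map _ t 2 / (1 - stdSimplex.map _ t 0)) = σ t
  rw [h0, h2, sub_zero, div_one, param_apply]
  simp

theorem face_cone_one (σ : Simplex 1 D) :
    face 1 1 (cone σ) = segmentTo (σ (stdSimplex.vertex 1)) := by
  ext t
  have h0 : stdSimplex.map (Fin.succAbove (1 : Fin 3)) t 0 = t 0 := by
    rw [map_succAbove, Fin.sum_univ_two]; simp [Fin.succAbove, Fin.ext_iff]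
  have h2 : stdSimplex.map (Fin.succAbove (1 : Fin 3)) t 2 = t 1 := by
    rw [map_succAbove, Fin.sum_univ_two]; simp [Fin.succAbove, Fin.ext_iff]
  change ((1 - stdSimplex.map _ t 0 : ℝ) : ℂ) *
    param σ (stdSimplex.map _ t 2 / (1 - stdSimplex.map _ t 0)) =
    ((t 1 : ℝ) : ℂ) * _
  have h := stdSimplex_add t
  rw [h0, h2, show 1 - t 0 = t 1 by linarith]
  -- At the apex `t 1 / t 1` is not `1`, but both sides are zero.
  by_cases h1 : t 1 = 0
  · simp [h1]
  · rw [div_self h1, param_one]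

theorem face_cone_two (σ : Simplex 1 D) :
    face 1 2 (cone σ) = segmentTo (σ (stdSimplex.vertex 0)) := by
  ext t
  have h0 : stdSimplex.map (Fin.succAbove (2 : Fin 3)) t 0 = t 0 := by
    rw [map_succAbove, Fin.sum_univ_two]; simp [Fin.succAbove]
  have h2 : stdSimplex.map (Fin.succAbove (2 : Fin 3)) t 2 = 0 := by
    rw [map_succAbove, Fin.sum_univ_two]; simp [Fin.succAbove, Fin.ext_iff]
  change ((1 - stdSimplex.map _ t 0 : ℝ) : ℂ) *
    param σ (stdSimplex.map _ t 2 / (1 - stdSimplex.map _ t 0)) =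
    ((t 1 : ℝ) : ℂ) * _
  have h := stdSimplex_add t
  rw [h0, h2, show 1 - t 0 = t 1 by linarith, zero_div, param_zero]

end Disk

/-! ### Relative first homology of a disk, detected by boundary coefficients -/

namespace SingularRel

variable (R : Type) [CommRing R] {X : Type u} [TopologicalSpace X]

theorem face_zero_apply (i : Fin 2) (σ : Simplex 1 X) :
    face 0 i σ default = σ (stdSimplex.vertex (i.succAbove 0)) := by
  rw [show (default : stdSimplex ℝ (Fin 1)) = stdSimplex.vertex 0 from Subsingleton.elim _ _]
  simp [face]

theorem boundary_zero_single (σ : Simplex 1 X) : boundary R 0 (Finsupp.single σ 1) =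
    Finsupp.single (face 0 0 σ) 1 - Finsupp.single (face 0 1 σ) 1 := by
  rw [boundary_single, Fin.sum_univ_two]
  simp [sub_eq_add_neg]

theorem boundary_one_single (σ : Simplex 2 X) : boundary R 1 (Finsupp.single σ 1) =
    Finsupp.single (face 1 0 σ) 1 - Finsupp.single (face 1 1 σ) 1 +
      Finsupp.single (face 1 2 σ) 1 := by
  rw [boundary_single, Fin.sum_univ_three]
  simp [sub_eq_add_neg]

/-- First homology of a disk vanishes, by an explicit contracting homotopy transported along `f`:
`K` cones off a 1-simplex and `k` sends a point to the segment from the origin. The faces of a cone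
are the simplex and the segments to its two ends, so `∂K + k∂ = id` on 1-chains, and `K c` bounds
the cycle `c`. -/
theorem exists_boundary_eq (f : X ≃ₜ Disk.D) (c : Chain R 1 X) (hc : boundary R 0 c = 0) :
    ∃ c', boundary R 1 c' = c := by
  let push (n : ℕ) (σ : Simplex n X) : Simplex n Disk.D := (f : C(X, Disk.D)).comp σ
  let pull (n : ℕ) (σ : Simplex n Disk.D) : Simplex n X := (f.symm : C(Disk.D, X)).comp σ
  have hpp (n : ℕ) (σ : Simplex n X) : pull n (push n σ) = σ := by
    ext t; simp [push, pull]
  have hface (i : Fin 3) (σ : Simplex 2 Disk.D) : face 1 i (pull 2 σ) = pull 1 (face 1 i σ) := rfl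
  let K : Chain R 1 X →ₗ[R] Chain R 2 X :=
    Finsupp.lmapDomain R R fun σ => pull 2 (Disk.cone (push 1 σ))
  let k : Chain R 0 X →ₗ[R] Chain R 1 X :=
    Finsupp.lmapDomain R R fun σ => pull 1 (Disk.segmentTo (push 0 σ default))
  have key : boundary R 1 ∘ₗ K + k ∘ₗ boundary R 0 = LinearMap.id := by
    ext1 σ
    ext1
    have h0 : push 0 (face 0 0 σ) default = push 1 σ (stdSimplex.vertex 1) :=
      congrArg f (face_zero_apply 0 σ)
    have h1 : push 0 (face 0 1 σ) default = push 1 σ (stdSimplex.vertex 0) :=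
      congrArg f (face_zero_apply 1 σ)
    have hK : K (Finsupp.single σ 1) = Finsupp.single (pull 2 (Disk.cone (push 1 σ))) 1 :=
      Finsupp.mapDomain_single
    have hk (τ : Simplex 0 X) : k (Finsupp.single τ 1) =
        Finsupp.single (pull 1 (Disk.segmentTo (push 0 τ default))) 1 :=
      Finsupp.mapDomain_single
    rw [LinearMap.comp_apply, LinearMap.add_apply, LinearMap.comp_apply, LinearMap.comp_apply,
      Finsupp.lsingle_apply, hK, boundary_one_single, hface, hface, hface, Disk.face_cone_zero,
      Disk.face_cone_one, Disk.face_cone_two, hpp, boundary_zero_single, map_sub, hk, hk, h0, h1]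
    simp
  refine ⟨K c, ?_⟩
  have := LinearMap.congr_fun key c
  simpa [hc] using this

/-- The point `x` as a singular `0`-simplex. -/
def pointSimplex (x : X) : Simplex 0 X := ContinuousMap.const _ x

theorem eq_pointSimplex (σ : Simplex 0 X) : σ = pointSimplex (σ default) := by
  ext t
  rw [Subsingleton.elim t default]
  rfl

theorem boundary_pathSimplex {x y : X} (γ : Path x y) :
    boundary R 0 (Finsupp.single (pathSimplex γ) 1) =
      Finsupp.single (pointSimplex y) 1 - Finsupp.single (pointSimplex x) 1 := by
  rw [boundary_zero_single, eq_pointSimplex (face 0 0 _),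
    eq_pointSimplex (face 0 1 _), face_zero_apply, face_zero_apply]
  have h0 : pathSimplex γ (stdSimplex.vertex ((0 : Fin 2).succAbove 0)) = y := by
    simp [pathSimplex]
  have h1 : pathSimplex γ (stdSimplex.vertex ((1 : Fin 2).succAbove 0)) = x := by
    simp [pathSimplex]
  rw [h0, h1]

theorem single_pathSimplex_mem {S : Set X} {x y : S} (γ : Path x y) :
    Finsupp.single (pathSimplex (γ.map continuous_subtype_val)) (1 : R) ∈ chainsIn R 1 S := by
  refine Submodule.subset_span ⟨_, ?_, rfl⟩
  rintro _ ⟨t, rfl⟩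
  exact (γ _).2

theorem countIn_pointSimplex {S : Set X} [DecidableEq (ConnectedComponents S)]
    (I : ConnectedComponents S) (x : S) :
    countIn R (componentSet I) (Finsupp.single (pointSimplex (x : X)) 1) =
      if ConnectedComponents.mk x = I then 1 else 0 := by
  classical
  rw [countIn_single]
  refine if_congr ?_ rfl rfl
  exact ⟨fun ⟨_, h⟩ => h, fun h => ⟨x.2, h⟩⟩

section components

variable {S : Set X} [Fintype (ConnectedComponents S)]

/-- If the components of `S` are path connected, then every `0`-chain of `S` is homologous in `S`
to a combination of base points of the components. -/
theorem sub_sum_countIn_mem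
    (hS : ∀ x y : S, (ConnectedComponents.mk x : ConnectedComponents S) = ConnectedComponents.mk y →
      Joined x y) (base : ConnectedComponents S → S)
    (hbase : ∀ I, ConnectedComponents.mk (base I) = I) (c : Chain R 0 X)
    (hc : c ∈ chainsIn R 0 S) :
    c - ∑ I, countIn R (componentSet I) c • Finsupp.single (pointSimplex (base I : X)) 1 ∈
      (chainsIn R 1 S).map (boundary R 0) := by
  classical
  induction hc using Submodule.span_induction with
  | zero => simp
  | add x y _ _ hx hy =>
    convert add_mem hx hy using 1
    simp only [map_add, add_smul, Finset.sum_add_distrib]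
    abel
  | smul r x _ hx =>
    convert Submodule.smul_mem _ r hx using 1
    simp only [map_smul, smul_sub, Finset.smul_sum, smul_eq_mul, mul_smul]
  | mem c hc =>
    obtain ⟨σ, hσ, rfl⟩ := hc
    rw [eq_pointSimplex σ]
    obtain ⟨x, hx⟩ : ∃ x : S, (x : X) = σ default := ⟨⟨_, hσ ⟨default, rfl⟩⟩, rfl⟩
    rw [← hx]
    simp_rw [countIn_pointSimplex R, ite_smul, one_smul, zero_smul]
    rw [Finset.sum_ite_eq Finset.univ, if_pos (Finset.mem_univ _)]
    -- A path inside `S` from the base point to `x` has the required difference as its boundary.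
    obtain ⟨γ⟩ := hS (base (ConnectedComponents.mk x)) x (hbase _)
    exact ⟨_, single_pathSimplex_mem R γ, boundary_pathSimplex R _⟩

/-- For a 0-chain in `S`, the sum over all components is its augmentation, the sum of all its
coefficients. This vanishes on boundaries of 1-chains. -/
theorem sum_countIn_boundary (c : Chain R 1 X) (hc : c ∈ relCycles R S) :
    ∑ I : ConnectedComponents S, countIn R (componentSet I) (boundary R 0 c) = 0 := by
  classical
  have h1 (c : Chain R 0 X) (hc : c ∈ chainsIn R 0 S) :
      ∑ I : ConnectedComponents S, countIn R (componentSet I) c = countIn R Set.univ c := by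
    induction hc using Submodule.span_induction with
    | zero => simp
    | add x y _ _ hx hy => simp only [map_add, Finset.sum_add_distrib, hx, hy]
    | smul r x _ hx => simp only [map_smul, ← Finset.smul_sum, hx]
    | mem c hc =>
      obtain ⟨σ, hσ, rfl⟩ := hc
      rw [eq_pointSimplex σ]
      obtain ⟨x, hx⟩ : ∃ x : S, (x : X) = σ default := ⟨⟨_, hσ ⟨default, rfl⟩⟩, rfl⟩
      rw [← hx]
      simp_rw [countIn_pointSimplex R]
      rw [Finset.sum_ite_eq Finset.univ, if_pos (Finset.mem_univ _), countIn_single,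
        if_pos (Set.mem_univ _)]
  rw [h1 _ hc]
  have h2 : countIn (X := X) R Set.univ ∘ₗ boundary R 0 = 0 := by
    ext1 σ
    ext1
    rw [LinearMap.comp_apply, LinearMap.comp_apply, Finsupp.lsingle_apply, boundary_zero_single,
      map_sub, countIn_single, countIn_single, if_pos (Set.mem_univ _), if_pos (Set.mem_univ _),
      sub_self]
    rfl
  exact LinearMap.congr_fun h2 c

end components

/-- The pairing of `H_1(X, S)` with the class dual to a component of `S`. -/
theorem dualClass_connecting_mk {S : Set X} (I : ConnectedComponents S) (c : Chain R 1 X)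
    (hc : c ∈ relCycles R S) :
    dualClass R I (connecting R S ⟨(relBoundaries R S).mkQ c, c, hc, rfl⟩) =
      countIn R (componentSet I) (boundary R 0 c) := rfl

theorem dualClass_arcClass {S : Set X} [DecidableEq (ConnectedComponents S)]
    (I J K : ConnectedComponents S) {x y : X} (γ : Path x y) (hx : x ∈ componentSet J)
    (hy : y ∈ componentSet K) :
    dualClass R I (connecting R S (arcClass R γ hx.1 hy.1)) =
      (if K = I then 1 else 0) - if J = I then 1 else 0 := by
  refine (dualClass_connecting_mk R I _ (pathSimplex_mem R γ hx.1 hy.1)).trans ?_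
  obtain ⟨hx, rfl⟩ := hx
  obtain ⟨hy, rfl⟩ := hy
  rw [boundary_pathSimplex, map_sub, ← countIn_pointSimplex R, ← countIn_pointSimplex R]

theorem sum_dualClass {S : Set X} [Fintype (ConnectedComponents S)] (z : H1 R S) :
    ∑ I : ConnectedComponents S, dualClass R I (connecting R S z) = 0 := by
  obtain ⟨_, c, hc, rfl⟩ := z
  exact sum_countIn_boundary R c hc

/-- A class in `H_1(X, S)` is determined by its boundary, if `X` is a disk and the components of
`S` are path connected. -/
theorem eq_zero_of_dualClass (f : X ≃ₜ Disk.D) {S : Set X} [Fintype (ConnectedComponents S)]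
    (hS : ∀ x y : S, (ConnectedComponents.mk x : ConnectedComponents S) = ConnectedComponents.mk y →
      Joined x y) (z : H1 R S)
    (hz : ∀ I : ConnectedComponents S, dualClass R I (connecting R S z) = 0) : z = 0 := by
  obtain ⟨_, c, hc, rfl⟩ := z
  choose base hbase using ConnectedComponents.surjective_coe (α := S)
  have h := sub_sum_countIn_mem R hS base hbase (boundary R 0 c) hc
  have h0 (I : ConnectedComponents S) : countIn R (componentSet I) (boundary R 0 c) = 0 := hz I
  -- The boundary of `c` is now the boundary of a chain `c'` in `S`. So `c - c'` is an absolute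
  -- cycle of the disk, hence a boundary, and `c` is a relative boundary.
  simp only [h0, zero_smul, Finset.sum_const_zero, sub_zero] at h
  obtain ⟨c', hc', h'⟩ := h
  obtain ⟨b, hb⟩ := exists_boundary_eq R f (c - c') (by rw [map_sub, h', sub_self])
  refine Subtype.ext ((Submodule.Quotient.mk_eq_zero _).2 ?_)
  rw [← sub_add_cancel c c', ← hb]
  exact Submodule.add_mem_sup ⟨b, rfl⟩ hc'

end SingularRel

/-! ### The intervals of the positive boundary of the model disk -/

namespace Disk
open SingularRel

/-- The angle is rescaled by `p + 1` so that the interval around each center becomes `|τ| < π / 2`,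
the same for all `p` and `k`. -/
theorem height_rot_center (p : ℕ) (k : Fin (p + 1)) (τ : ℝ) :
    height p (rot (center p k) (τ / (p + 1))) = Real.cos τ := by
  have h1 : ((p : ℝ) + 1) * (τ / (p + 1)) = τ := by field_simp
  rw [height_rot, neg_center_pow, one_mul, h1, Complex.exp_ofReal_mul_I_re]

theorem rot_center_mem (p : ℕ) (k : Fin (p + 1)) {τ : ℝ} (hτ : |τ| < Real.pi / 2) :
    rot (center p k) (τ / (p + 1)) ∈ plus p := by
  refine ⟨(norm_rot _ _).trans (center_mem p _).1, ?_⟩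
  rw [height_rot_center]
  exact Real.cos_pos_of_mem_Ioo (abs_lt.1 hτ)

theorem joined_rot_center (p : ℕ) (k : Fin (p + 1)) {τ : ℝ} (hτ : |τ| < Real.pi / 2) :
    Joined (centerPt p k) ⟨rot (center p k) (τ / (p + 1)), rot_center_mem p k hτ⟩ := by
  have h (t : unitInterval) : |(t : ℝ) * τ| < Real.pi / 2 := by
    rw [abs_mul, abs_of_nonneg t.2.1]
    exact (mul_le_of_le_one_left (abs_nonneg _) t.2.2).trans_lt hτ
  refine ⟨⟨⟨fun t => ⟨rot (center p k) (t * τ / (p + 1)), rot_center_mem p k (h t)⟩, ?_⟩, ?_, ?_⟩⟩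
  · unfold rot; fun_prop
  · apply Subtype.ext
    apply Subtype.ext
    simp [rot, centerPt]
  · apply Subtype.ext
    simp

theorem exists_rot_center_eq (p : ℕ) (z : plus p) : ∃ (k : Fin (p + 1)) (τ : ℝ)
    (hτ : |τ| < Real.pi / 2), z = ⟨rot (center p k) (τ / (p + 1)), rot_center_mem p k hτ⟩ := by
  obtain ⟨z, hz⟩ := z
  have hprim := Complex.isPrimitiveRoot_exp (p + 1) (by omega)
  -- The inverse appears because the centers are numbered clockwise, against the powers of the
  -- standard primitive root.
  obtain ⟨k, hk, hk'⟩ := hprim.eq_pow_of_pow_eq_one (ξ := (root p z)⁻¹)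
    (by rw [inv_pow, root_pow p hz, inv_one])
  have hroot : root p z = -(center p ⟨k, hk⟩ : ℂ) := by
    rw [neg_center, Complex.exp_neg, ← inv_inj, inv_inv, ← hk', ← Complex.exp_nat_mul]
    congr 1
    simp
    ring
  refine ⟨⟨k, hk⟩, Complex.arg ((-(z : ℂ)) ^ (p + 1)),
    Complex.abs_arg_lt_pi_div_two_iff.2 (Or.inl hz.2), ?_⟩
  set θ := Complex.arg ((-(z : ℂ)) ^ (p + 1)) with hθ
  have hlog : Complex.log ((-(z : ℂ)) ^ (p + 1)) = θ * Complex.I := by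
    rw [Complex.log, norm_pow_eq p hz.1]; simp [hθ]
  apply Subtype.ext
  apply Subtype.ext
  change (z : ℂ) = (center p ⟨k, hk⟩ : ℂ) * _
  rw [← neg_inj, ← neg_mul, ← hroot, root, hlog, mul_assoc, ← Complex.exp_add]
  have : -((θ : ℂ) * Complex.I / (p + 1)) + ((θ / (p + 1) : ℝ) : ℂ) * Complex.I = 0 := by
    push_cast; ring
  rw [this, Complex.exp_zero, mul_one]

/-- Every point is joined to the center of its interval, and different centers lie in different
components, so two points of one component share a center. -/
theorem joined_of_mk_eq (p : ℕ) (x y : plus p)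
    (h : (ConnectedComponents.mk x : ConnectedComponents (plus p)) = ConnectedComponents.mk y) :
    Joined x y := by
  obtain ⟨k, τ, hτ, rfl⟩ := exists_rot_center_eq p x
  obtain ⟨l, τ', hτ', rfl⟩ := exists_rot_center_eq p y
  have h1 := joined_rot_center p k hτ
  have h2 := joined_rot_center p l hτ'
  have hkl : k = l := centerPt_injective p
    ((ConnectedComponents.mk_eq_of_joined h1).trans
      (h.trans (ConnectedComponents.mk_eq_of_joined h2).symm))
  subst hkl
  exact h1.symm.trans h2

/-- The intervals are open at the sutures, where the height tends to zero without reaching it. So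
the height has no minimum on a component, which shows that no component is compact. -/
theorem exists_height_lt (p : ℕ) (x : plus p) : ∃ y : plus p, Joined x y ∧
    height p y < height p x := by
  obtain ⟨k, τ, hτ, rfl⟩ := exists_rot_center_eq p x
  have hcos : 0 < Real.cos τ := Real.cos_pos_of_mem_Ioo (abs_lt.1 hτ)
  have hle := Real.cos_le_one τ
  -- The chosen point has half the height of `x` and lies in the same interval.
  have hτ' : |Real.arccos (Real.cos τ / 2)| < Real.pi / 2 := by
    rw [abs_of_nonneg (Real.arccos_nonneg _), Real.arccos_lt_pi_div_two]
    linarith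
  refine ⟨⟨_, rot_center_mem p k hτ'⟩,
    (joined_rot_center p k hτ).symm.trans (joined_rot_center p k hτ'), ?_⟩
  dsimp only
  rw [height_rot_center, height_rot_center, Real.cos_arccos (by linarith) (by linarith)]
  linarith

theorem minus_nonempty (p : ℕ) : (minus p).Nonempty := by
  -- The point of height `cos π = -1`, in the middle of a neighbouring interval of `S₋`.
  refine ⟨rot (center p 0) (Real.pi / (p + 1)), (norm_rot _ _).trans (center_mem p _).1, ?_⟩
  rw [height_rot_center, Real.cos_pi]
  norm_num

end Disk

/-! ### The component counts of an open tuple of pants -/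

namespace SuturedSurface
open SingularRel

variable {p : ℕ} {P : SuturedSurface.{u} p 1} (ψ : SuturedSurface.Iso P (openPants p))

/-- The homeomorphism from an open `p`-tuple of pants to the disk. -/
def Iso.toDisk : P.carrier ≃ₜ Disk.D := ψ.diffeo.toHomeomorph

/-- The homeomorphism between the positive boundaries. -/
def Iso.plusHomeo : P.Splus ≃ₜ Disk.plus p :=
  ψ.toDisk.subtype fun x => by
    have h : ψ.toDisk '' P.Splus = Disk.plus p := ψ.map_plus
    change x ∈ P.Splus ↔ ψ.toDisk x ∈ Disk.plus p
    rw [← h, ψ.toDisk.injective.mem_set_image]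

include ψ

theorem Iso.joined_of_mk_eq (x y : P.Splus)
    (h : (ConnectedComponents.mk x : ConnectedComponents P.Splus) = ConnectedComponents.mk y) :
    Joined x y := by
  have h' : (ConnectedComponents.mk (ψ.plusHomeo x) : ConnectedComponents (Disk.plus p)) =
      ConnectedComponents.mk (ψ.plusHomeo y) := by
    have := congrArg ψ.plusHomeo.continuous.connectedComponentsMap h
    exact this
  have := (Disk.joined_of_mk_eq p _ _ h').map ψ.plusHomeo.symm.continuous
  simpa using this

/-- A circle is compact, so the height pulled back from the disk would attain a minimum on it,
against `Disk.exists_height_lt`. -/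
theorem Iso.not_isCircle (I : ConnectedComponents P.Splus) : ¬ P.IsCircle I := by
  rintro ⟨g⟩
  have : CompactSpace (componentSet I) := g.symm.compactSpace
  have : Nonempty (componentSet I) := ⟨g.symm 1⟩
  obtain ⟨⟨x, hx, hxI⟩, -, hmin⟩ := IsCompact.exists_isMinOn isCompact_univ Set.univ_nonempty
    (((Disk.continuous_height p).comp (ψ.toDisk.continuous.comp
      (continuous_subtype_val (p := (· ∈ componentSet I))))).continuousOn (s := Set.univ))
  obtain ⟨y, hy, hlt⟩ := Disk.exists_height_lt p (ψ.plusHomeo ⟨x, hx⟩)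
  have hj : Joined (⟨x, hx⟩ : P.Splus) (ψ.plusHomeo.symm y) := by
    simpa using hy.map ψ.plusHomeo.symm.continuous
  have hmem : (ψ.plusHomeo.symm y : P.carrier) ∈ componentSet I :=
    ⟨(ψ.plusHomeo.symm y).2, (ConnectedComponents.mk_eq_of_joined hj).symm.trans hxI⟩
  have h1 := isMinOn_iff.1 hmin ⟨_, hmem⟩ trivial
  have h2 : ψ.toDisk (ψ.plusHomeo.symm y : P.carrier) = y :=
    congrArg Subtype.val (ψ.plusHomeo.apply_symm_apply y)
  simp only [Function.comp_apply, h2] at h1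
  exact absurd hlt (not_lt.2 h1)

/-- The disk is connected, so there is only one component to meet. Applied to `S₋` and to the
boundary, this makes `a_-` and `c` vanish. -/
theorem Iso.meets (C : ConnectedComponents P.carrier) {T : Set P.carrier} (hT : T.Nonempty) :
    P.Meets C T := by
  have hD : PreconnectedSpace Disk.D :=
    isPreconnected_iff_preconnectedSpace.1 (convex_closedBall (0 : ℂ) 1).isPreconnected
  have : PreconnectedSpace P.carrier :=
    ψ.toDisk.symm.surjective.denseRange.preconnectedSpace ψ.toDisk.symm.continuous
  obtain ⟨x, hx⟩ := hT
  exact ⟨x, hx, Subsingleton.elim _ _⟩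

theorem Iso.sminus_nonempty : P.Sminus.Nonempty := by
  have h : (ψ.diffeo '' P.Sminus).Nonempty := by
    rw [ψ.map_minus]; exact Disk.minus_nonempty p
  exact h.of_image

theorem Iso.numNoMinus_eq : P.numNoMinus = 0 := by
  have : {C | P.Meets C P.bdry ∧ ¬ P.Meets C P.Sminus} = ∅ :=
    Set.eq_empty_of_forall_notMem fun C hC => hC.2 (ψ.meets C ψ.sminus_nonempty)
  rw [numNoMinus, this, Set.ncard_empty]

theorem Iso.numClosed_eq : P.numClosed = 0 := by
  have h : P.bdry.Nonempty := ψ.sminus_nonempty.mono fun x hx =>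
    (P.union ▸ Set.mem_union_right P.Splus hx : x ∈ P.bdry \ P.Λ).1
  have : {C | ¬ P.Meets C P.bdry} = ∅ :=
    Set.eq_empty_of_forall_notMem fun C hC => hC (ψ.meets C h)
  rw [numClosed, this, Set.ncard_empty]

theorem Iso.numCircles_eq : P.numCircles = 0 := by
  have : {I | P.IsCircle I} = ∅ :=
    Set.eq_empty_of_forall_notMem fun I hI => ψ.not_isCircle I hI
  rw [numCircles, this, Set.ncard_empty]

end SuturedSurface

/-! ### Pairing of the arcs with the boundary functionals, and the isomorphism -/

namespace PantsArcs

variable (R : Type) [CommRing R] {p : ℕ} {P : SuturedSurface.{u} p 1} (γ : PantsArcs P)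

/-- The functional of an incoming component counts end minus start, and only the `i`-th arc touches
the `i`-th incoming interval. The orientation convention in `e` turns this into the sign that
`contractRight_wedge` needs. -/
theorem φ_inc_e (i j : Fin p) :
    P.φ R (P.inc j) (γ.e R i) = if i = j then (-1 : R) ^ (p - (j + 1 : ℕ)) else 0 := by
  classical
  have hij : (P.inc i = P.inc j) = (i = j) := by
    refine propext ⟨fun h => ?_, fun h => h ▸ rfl⟩
    exact Sum.inl_injective (P.label_bijective.1 (a₁ := Sum.inl i) (a₂ := Sum.inl j) h)
  have hout : P.out 0 ≠ P.inc j := fun h =>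
    Sum.inr_ne_inl (P.label_bijective.1 (a₁ := Sum.inr 0) (a₂ := Sum.inl j) h)
  rw [e, SuturedSurface.φ, LinearMap.comp_apply]
  split_ifs with h1 h2 h2
  · rw [SingularRel.dualClass_arcClass R _ _ _ _ (γ.left_mem i) (γ.right_mem i), if_neg hout,
      ← h2, if_pos rfl, h1.neg_one_pow, sub_zero]
  · rw [SingularRel.dualClass_arcClass R _ _ _ _ (γ.left_mem i) (γ.right_mem i), if_neg hout,
      if_neg (by rwa [hij]), sub_zero]
  · rw [SingularRel.dualClass_arcClass R _ _ _ _ (γ.right_mem i) (γ.left_mem i), if_neg hout,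
      ← h2, if_pos rfl, (Nat.not_even_iff_odd.1 h1).neg_one_pow, zero_sub]
  · rw [SingularRel.dualClass_arcClass R _ _ _ _ (γ.right_mem i) (γ.left_mem i), if_neg hout,
      if_neg (by rwa [hij]), sub_zero]

theorem φ_out_eq (i : Fin 1) : P.φ R (P.out i) = -∑ j, P.φ R (P.inc j) := by
  have := Fintype.ofBijective _ P.label_bijective
  ext z
  have h := SingularRel.sum_dualClass R z
  rw [← (Equiv.ofBijective _ P.label_bijective).sum_comp, Fintype.sum_sum_type,
    Fin.sum_univ_one] at h
  rw [LinearMap.neg_apply, LinearMap.sum_apply, Subsingleton.elim i 0]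
  exact eq_neg_of_add_eq_zero_right h

variable (ψ : SuturedSurface.Iso P (openPants p))
include ψ

/-- The outgoing functional vanishes along with the incoming ones by `φ_out_eq`, so the boundary
coefficients on all components are zero. -/
theorem eq_zero_of_φ_inc (z : P.H R) (hz : ∀ j, P.φ R (P.inc j) z = 0) : z = 0 := by
  have := Fintype.ofBijective _ P.label_bijective
  refine SingularRel.eq_zero_of_dualClass R ψ.toDisk ψ.joined_of_mk_eq z fun I => ?_
  obtain ⟨j | i, rfl⟩ := P.label_bijective.2 I
  · exact hz j
  · have h := LinearMap.congr_fun (φ_out_eq R (P := P) i) z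
    rw [LinearMap.neg_apply, LinearMap.sum_apply, Finset.sum_eq_zero fun j _ => hz j,
      neg_zero] at h
    exact h

/-- The incoming functionals are jointly injective and are dual to the `e i` up to signs.
Independence follows from evaluating them on a relation; spanning follows by subtracting from `z`
the combination with the same values. -/
theorem isBasis : γ.IsBasis R := by
  have hsq (j : Fin p) : (-1 : R) ^ (p - (j + 1 : ℕ)) * (-1) ^ (p - (j + 1 : ℕ)) = 1 := by
    rw [← mul_pow]; simp
  have hsum (c : Fin p → R) (j : Fin p) :
      P.φ R (P.inc j) (∑ i, c i • γ.e R i) = c j * (-1 : R) ^ (p - (j + 1 : ℕ)) := by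
    simp [map_sum, φ_inc_e]
  constructor
  · rw [Fintype.linearIndependent_iff]
    intro c hc j
    have h := hsum c j
    rw [hc, map_zero] at h
    calc c j = c j * ((-1 : R) ^ (p - (j + 1 : ℕ)) * (-1) ^ (p - (j + 1 : ℕ))) := by
          rw [hsq, mul_one]
      _ = 0 := by rw [← mul_assoc, ← h, zero_mul]
  · refine eq_top_iff.2 fun z _ => ?_
    have h : z = ∑ i, (P.φ R (P.inc i) z * (-1 : R) ^ (p - (i + 1 : ℕ))) • γ.e R i := by
      rw [← sub_eq_zero]
      refine eq_zero_of_φ_inc R ψ _ fun j => ?_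
      rw [map_sub, hsum, mul_assoc, hsq, mul_one, sub_self]
    rw [h]
    exact Submodule.sum_mem _ fun i _ => Submodule.smul_mem _ _ (Submodule.subset_span ⟨i, rfl⟩)

theorem exists_bimoduleEquiv (A : Fin 4 → ℚ) (N : Fin 4 → ZMod 2) (hδ : P.δ A = -p)
    (hparity : P.parity N = p) :
    ∃ Φ : P.Z R N ≃+ (GrAlg.dualPow R p).carrier,
      (∀ s : Finset (Fin p), Φ (P.pureTensor R N (γ.wedge R s)) = GrAlg.prodE R p sᶜ) ∧
      (∀ (q : ℚ) (a : ZMod 2),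
        Φ '' (P.gr R N A q a : Set (P.Z R N)) =
          ((GrAlg.dualPow R p).superGr q a : Set (GrAlg.dualPow R p).carrier)) ∧
      (∀ (a : DualNumber R) (z : P.Z R N),
        Φ (P.lact R N (GrAlg.incl 1 0 a) z) = GrAlg.iterCoproduct p a * Φ z) ∧
      (∀ (z : P.Z R N) (b : (GrAlg.dualPow R p).carrier),
        Φ (P.ract R N z b) = Φ z * b) := by
  have hbasis := γ.isBasis R ψ
  let b : Module.Basis (Fin p) R (P.H R) := Module.Basis.mk hbasis.1 hbasis.2.ge
  have hb : ⇑b = γ.e R := Module.Basis.coe_mk _ _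
  -- The prefactor has `0` or `1` factors, but only the parity of their number enters the left
  -- action.
  have hk : (-1 : R) ^ (P.parity N).val = (-1) ^ p := by
    rw [hparity, ZMod.val_natCast, ← neg_one_pow_eq_pow_mod_two]
  have hd (i j : Fin p) : P.φ R (P.inc j) (b i) =
      if i = j then (-1 : R) ^ (p - (j + 1 : ℕ)) else 0 := by
    rw [hb, φ_inc_e R γ]
  have hwedge (s : Finset (Fin p)) : P.pureTensor R N (γ.wedge R s) =
      ShiftedExt.basis (P.parity N).val b s := by
    rw [ShiftedExt.basis_apply, hb]
    rfl
  let Φ := ShiftedExt.bimoduleEquiv (P.parity N).val b (fun j => P.φ R (P.inc j)) hd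
  have hΦ (s : Finset (Fin p)) : Φ (ShiftedExt.basis (P.parity N).val b s) =
      GrAlg.prodE R p sᶜ := ShiftedExt.bimoduleEquiv_basis _ b _ hd s
  refine ⟨Φ.toAddEquiv, fun s => ?_, fun q a => ?_, fun a z => ?_, fun z x => ?_⟩
  · rw [hwedge]
    exact hΦ s
  · change ((P.gr R N A q a).map Φ.toLinearMap : Set (GrAlg.dualPow R p).carrier) = _
    rw [SetLike.coe_set_eq, GrAlg.superGr_dualPow, SuturedSurface.gr]
    simp_rw [ShiftedExt.wedgePart_eq_span (P.parity N).val b, ← Submodule.span_iUnion,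
      ← Set.image_iUnion]
    rw [Submodule.map_span, ← Set.image_comp]
    congr 1
    have hcard (s : Finset (Fin p)) : (s.card : ℚ) + (sᶜ.card : ℚ) = p := by
      rw [← Nat.cast_add, Finset.card_add_card_compl, Fintype.card_fin]
    have hcard' (s : Finset (Fin p)) : (s.card : ZMod 2) + (sᶜ.card : ZMod 2) = p := by
      rw [← Nat.cast_add, Finset.card_add_card_compl, Fintype.card_fin]
    -- In `ℚ`, `s.card - p = -sᶜ.card`; modulo 2, `s.card + p = sᶜ.card` because `s.card` occurs
    -- twice. So `Φ` matches the spanning sets of both graded parts.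
    have hdeg (s : Finset (Fin p)) : ((s.card : ℚ) + P.δ A = q ∧
        (s.card : ZMod 2) + P.parity N = a) ↔ (-(sᶜ.card : ℚ) = q ∧ (sᶜ.card : ZMod 2) = a) := by
      rw [hδ, hparity, ← hcard s, ← hcard' s, ← add_assoc, CharTwo.add_self_eq_zero, zero_add]
      simp
    ext x
    simp only [Set.mem_image, Set.mem_iUnion, Set.mem_ofPred_eq, exists_prop, Function.comp_apply]
    constructor
    · rintro ⟨s, ⟨k, hk, rfl⟩, rfl⟩
      exact ⟨sᶜ, (hdeg s).1 hk, (hΦ s).symm⟩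
    · rintro ⟨s, hs, rfl⟩
      refine ⟨sᶜ, ⟨_, (hdeg sᶜ).2 (by rwa [compl_compl]), rfl⟩, (hΦ sᶜ).trans ?_⟩
      rw [compl_compl]
  · exact ShiftedExt.bimoduleEquiv_leftAction _ b _ hd hk
      (fun i => P.φ R (P.out i)) (φ_out_eq R 0) a z
  · exact ShiftedExt.bimoduleEquiv_rightAction _ b _ hd z x

end PantsArcs

end

/-! ### The proposition over the integers -/

theorem proposition2p7 (p : ℕ) (A : Fin 4 → ℚ) (N : Fin 4 → ZMod 2) (hA : A 0 = 1) (hN : N 2 = 0)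
    (P : SuturedSurface.{u} p 1) (hP : P.IsOpenPants) (γ : PantsArcs P) :
    γ.IsBasis ℤ ∧
    ∃ Φ : P.Z ℤ N ≃+ (GrAlg.dualPow ℤ p).carrier,
      (∀ s : Finset (Fin p), Φ (P.pureTensor ℤ N (γ.wedge ℤ s)) = GrAlg.prodE ℤ p sᶜ) ∧
      (∀ (q : ℚ) (a : ZMod 2),
        Φ '' (P.gr ℤ N A q a : Set (P.Z ℤ N)) =
          ((GrAlg.dualPow ℤ p).superGr q a : Set (GrAlg.dualPow ℤ p).carrier)) ∧
      (∀ (a : DualNumber ℤ) (z : P.Z ℤ N),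
        Φ (P.lact ℤ N (GrAlg.incl 1 0 a) z) = GrAlg.iterCoproduct p a * Φ z) ∧
      (∀ (z : P.Z ℤ N) (b : (GrAlg.dualPow ℤ p).carrier),
        Φ (P.ract ℤ N z b) = Φ z * b) := by
  obtain ⟨ψ⟩ := hP
  have hbasis := γ.isBasis ℤ ψ
  have hh : P.h = p := by
    rw [SuturedSurface.h, SuturedSurface.rankH,
      Module.finrank_eq_card_basis (Module.Basis.mk hbasis.1 hbasis.2.ge), Fintype.card_fin]
  refine ⟨hbasis, γ.exists_bimoduleEquiv ℤ ψ A N ?_ ?_⟩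
  -- The numbers of intervals and of components without `S₊` are never computed: here their
  -- coefficients contain the factor `A 0 - 1 = 0`, and in the parity the intervals have coefficient
  -- `N 2 = 0`.
  · simp [SuturedSurface.δ, hh, hA, ψ.numNoMinus_eq, ψ.numClosed_eq, ψ.numCircles_eq]
  · simp [SuturedSurface.parity, hh, hN, ψ.numNoMinus_eq, ψ.numClosed_eq, ψ.numCircles_eq]
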